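/- Let $(M,g)$ be a smooth Lorentzian manifold of dimension $n\ge 4$ (signature $(-,+,\dots,+)$) that is a Kundt spacetime: it carries a smooth nowhere vanishing null vector field $\boldsymbol\ell$ such that, in null frames $m_{(0)}\propto\boldsymbol\ell$, $m_{(1)}=\boldsymbol n$, $m_{(i)}$ ($i=2,\dots,n-1$) aligned with $\boldsymbol\ell$, with $g(m_{(0)},\boldsymbol n)=1$, $g(m_{(i)},m_{(j)})=\delta_{ij}$ and all other products zero, the coefficients $L_{ab}=g(\nabla_{m_{(b)}}m_{(0)},m_{(a)})$ satisfy $L_{i0}=0=L_{ij}$. The boost weight of a covariant frame component of a tensor is the number of its indices $0$ minus the number of its indices $1$. A tensor is of aligned type II (resp. III) or more special if in the null frames aligned with $\boldsymbol\ell$ all its components of boost weight $>0$ (resp. $\ge 0$) vanish. A tensor is balanced if, in null frames aligned with $\boldsymbol\ell$ and parallelly transported along their affinely parameterized geodesic null vector field $m_{(0)}$, each component $\eta$ of boost weight $b$ satisfies $\eta=0$ if $b\ge0$ and $D^{-b}\eta=0$ if $b<0$, where $D=\nabla_{m_{(0)}}$. Assume that the Weyl tensor and the tracefree part $R_{ab}-\frac{R}{n}g_{ab}$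 of the Ricci tensor are both of aligned type III or more special. Then: 1. the spacetime is degenerate Kundt, i.e. the Riemann tensor and its covariant derivatives $\nabla^{(I)}(\mathrm{Riem})$ of every order $I\ge 0$ are of aligned type II or more special; 2. for every integer $I\ge1$ the tensor $\nabla^{(I)}(\mathrm{Riem})$ is balanced, and it is of aligned type III or more special. -/

import Mathlib

open scoped Manifold ContDiff Topology

noncomputable section

namespace Kundt

/-- The model space of an `n`-dimensional manifold, where `n = d + 2` and `d` is the number of
transverse spacelike directions of a null frame. -/
abbrev Model (d : ℕ) : Type := EuclideanSpace ℝ (Fin (d + 2))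

/-- Vector fields (arbitrary sections of the tangent bundle; smoothness is asked for separately,
and possibly only on an open subset, off which the values are irrelevant). -/
abbrev VField (d : ℕ) (M : Type*) [TopologicalSpace M] [ChartedSpace (Model d) M] : Type _ :=
  Π x : M, TangentSpace 𝓘(ℝ, Model d) x

/-- Covariant `k`-tensor fields, as functions of `k` vector fields with values in the scalar
fields. -/
abbrev TensorField (d : ℕ) (M : Type*) [TopologicalSpace M] [ChartedSpace (Model d) M]
    (k : ℕ) : Type _ :=
  (Fin k → VField d M) → M → ℝ

/-- The metric components `g(m_a, m_b)` in a null frame `m₀ = ℓ`, `m₁ = n`, `m₂, m₃, …`: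
`ℓ` and `n` are null with `g(ℓ, n) = 1`, and the `mᵢ` are orthonormal, spacelike and orthogonal to
`ℓ` and `n`. -/
def nullEta (d : ℕ) (a b : Fin (d + 2)) : ℝ :=
  if a = 0 then (if b = 1 then 1 else 0)
  else if a = 1 then (if b = 0 then 1 else 0)
  else if a = b then 1 else 0

/-- The boost weight of a frame component with covariant indices `a₁ … a_k`: the number of indices
`0` minus the number of indices `1`. -/
def boostWeight {d k : ℕ} (a : Fin k → Fin (d + 2)) : ℤ :=
  ∑ j, (if a j = 0 then 1 else if a j = 1 then -1 else 0)

section Fields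

variable {d : ℕ} {M : Type*} [TopologicalSpace M] [ChartedSpace (Model d) M]

/-- The derivative `X f` of a scalar field along a vector field. -/
def dirDeriv (X : VField d M) (f : M → ℝ) (x : M) : ℝ :=
  mfderiv 𝓘(ℝ, Model d) 𝓘(ℝ, ℝ) f x (X x)

variable [IsManifold 𝓘(ℝ, Model d) ∞ M]

/-- The vector field `X` is smooth on `U`. -/
def SmoothOn (X : VField d M) (U : Set M) : Prop :=
  ContMDiffOn 𝓘(ℝ, Model d) (𝓘(ℝ, Model d)).tangent ∞
    (fun x => (⟨x, X x⟩ : TangentBundle 𝓘(ℝ, Model d) M)) U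

/-- The vector field `X` is smooth on a neighbourhood of `x`. -/
def SmoothNear (X : VField d M) (x : M) : Prop :=
  ∃ U : Set M, IsOpen U ∧ x ∈ U ∧ SmoothOn X U

end Fields

/-- A smooth Lorentzian metric, of signature `(-, +, …, +)`. -/
structure LorentzMetric (d : ℕ) (M : Type*) [TopologicalSpace M] [ChartedSpace (Model d) M]
    [IsManifold 𝓘(ℝ, Model d) ∞ M] where
  /-- The scalar product on each tangent space. -/
  val : ∀ x : M, TangentSpace 𝓘(ℝ, Model d) x →L[ℝ] TangentSpace 𝓘(ℝ, Model d) x →L[ℝ] ℝ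
  symm : ∀ (x : M) (v w : TangentSpace 𝓘(ℝ, Model d) x), val x v w = val x w v
  lorentzian : ∀ x : M, ∃ b : Module.Basis (Fin (d + 2)) ℝ (TangentSpace 𝓘(ℝ, Model d) x),
    ∀ i j, val x (b i) (b j) = if i = j then (if i = 0 then -1 else 1) else 0
  smooth : ContMDiff 𝓘(ℝ, Model d)
    (𝓘(ℝ, Model d).prod 𝓘(ℝ, Model d →L[ℝ] Model d →L[ℝ] ℝ)) ∞
    (fun x => Bundle.TotalSpace.mk' (Model d →L[ℝ] Model d →L[ℝ] ℝ)
      (E := fun x : M => TangentSpace 𝓘(ℝ, Model d) x →L[ℝ]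
        TangentSpace 𝓘(ℝ, Model d) x →L[ℝ] ℝ) x (val x))

namespace LorentzMetric

variable {d : ℕ} {M : Type*} [TopologicalSpace M] [ChartedSpace (Model d) M]
  [IsManifold 𝓘(ℝ, Model d) ∞ M] (g : LorentzMetric d M)

/-- The scalar field `g(X, Y)`. -/
def inner (X Y : VField d M) (x : M) : ℝ := g.val x (X x) (Y x)

/-- The right-hand side of the Koszul formula for `2 g(∇_X Y, Z)`. -/
def koszul (X Y Z : VField d M) (x : M) : ℝ :=
  dirDeriv X (g.inner Y Z) x + dirDeriv Y (g.inner X Z) x - dirDeriv Z (g.inner X Y) x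
    + g.inner (VectorField.mlieBracket 𝓘(ℝ, Model d) X Y) Z x
    - g.inner (VectorField.mlieBracket 𝓘(ℝ, Model d) X Z) Y x
    - g.inner (VectorField.mlieBracket 𝓘(ℝ, Model d) Y Z) X x

open Classical in
/-- The Levi-Civita covariant derivative `∇_X Y`: its value at `x` is the unique tangent vector `v`
with `2 g(v, Z) = koszul X Y Z` at `x` for all vector fields `Z` that are smooth near `x`. (Such a
vector exists whenever `X` and `Y` are smooth near `x`; only this case is meaningful.) -/
def nabla (X Y : VField d M) : VField d M := fun x =>
  if h : ∃ v : TangentSpace 𝓘(ℝ, Model d) x,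
      ∀ Z : VField d M, SmoothNear Z x → 2 * g.val x v (Z x) = g.koszul X Y Z x
  then h.choose else 0

/-- The curvature operator `R(X, Y) Z = ∇_X ∇_Y Z - ∇_Y ∇_X Z - ∇_[X, Y] Z`. -/
def curvature (X Y Z : VField d M) : VField d M := fun x =>
  g.nabla X (g.nabla Y Z) x - g.nabla Y (g.nabla X Z) x
    - g.nabla (VectorField.mlieBracket 𝓘(ℝ, Model d) X Y) Z x

/-- The Riemann tensor, `R_{abcd}`; that is, `Riem(W, Z, X, Y) = g(R(X, Y) Z, W)`. -/
def riemann : TensorField d M 4 := fun X =>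
  g.inner (g.curvature (X 2) (X 3) (X 1)) (X 0)

open Classical in
/-- The metric contraction `g^{ab} B_{ab}` of a 2-tensor field `B`: at `x`, it is the trace of the
unique endomorphism `A` of the tangent space with `g(A X, Y) = B(X, Y)` at `x` for all vector
fields `X`, `Y` that are smooth near `x`. (Such an `A` exists for every tensor field `B`; only this
case is meaningful.) -/
def contract (B : VField d M → VField d M → M → ℝ) (x : M) : ℝ :=
  if h : ∃ A : TangentSpace 𝓘(ℝ, Model d) x →ₗ[ℝ] TangentSpace 𝓘(ℝ, Model d) x,
      ∀ X Y : VField d M, SmoothNear X x → SmoothNear Y x → g.val x (A (X x)) (Y x) = B X Y x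
  then LinearMap.trace ℝ (TangentSpace 𝓘(ℝ, Model d) x) h.choose else 0

/-- The Ricci tensor, `R_{bd} = g^{ac} R_{abcd}`. -/
def ricci : TensorField d M 2 := fun X =>
  g.contract (fun V W => g.riemann ![V, X 0, W, X 1])

/-- The scalar curvature, `R = g^{ab} R_{ab}`. -/
def scalar : M → ℝ := g.contract (fun V W => g.ricci ![V, W])

/-- The tracefree part of the Ricci tensor, `R_{ab} - (R / n) g_{ab}` with `n = d + 2`. -/
def tracefreeRicci : TensorField d M 2 := fun X x =>
  g.ricci X x - g.scalar x / ((d : ℝ) + 2) * g.inner (X 0) (X 1) x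

/-- The Weyl tensor, with `n = d + 2`:
`C_{abcd} = R_{abcd} - (g_{ac} R_{bd} - g_{ad} R_{bc} - g_{bc} R_{ad} + g_{bd} R_{ac}) / (n - 2)
  + R (g_{ac} g_{bd} - g_{ad} g_{bc}) / ((n - 1) (n - 2))`. -/
def weyl : TensorField d M 4 := fun X x =>
  g.riemann X x
    - (g.inner (X 0) (X 2) x * g.ricci ![X 1, X 3] x
        - g.inner (X 0) (X 3) x * g.ricci ![X 1, X 2] x
        - g.inner (X 1) (X 2) x * g.ricci ![X 0, X 3] x
        + g.inner (X 1) (X 3) x * g.ricci ![X 0, X 2] x) / (d : ℝ)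
    + g.scalar x * (g.inner (X 0) (X 2) x * g.inner (X 1) (X 3) x
        - g.inner (X 0) (X 3) x * g.inner (X 1) (X 2) x) / (((d : ℝ) + 1) * (d : ℝ))

/-- The covariant derivative of a tensor field, the new argument being put first:
`(∇T)(X, Y₁, …, Y_k) = X (T(Y₁, …, Y_k)) - ∑ⱼ T(Y₁, …, ∇_X Yⱼ, …, Y_k)`. -/
def covDeriv {k : ℕ} (T : TensorField d M k) : TensorField d M (k + 1) := fun X x =>
  dirDeriv (X 0) (T (fun j => X j.succ)) x
    - ∑ j : Fin k,
        T (Function.update (fun i : Fin k => X i.succ) j (g.nabla (X 0) (X j.succ))) x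

/-- The iterated covariant derivative `∇^(I) T`. -/
def iterCovDeriv {k : ℕ} (T : TensorField d M k) : (I : ℕ) → TensorField d M (k + I)
  | 0 => T
  | I + 1 => g.covDeriv (iterCovDeriv T I)

/-- `e` is a smooth null frame `m₀, m₁, …, m_{n-1}` on the open set `U`, whose first null vector
`m₀` points in the null direction of `ℓ`. -/
structure IsAdaptedFrame (ℓ : VField d M) (U : Set M) (e : Fin (d + 2) → VField d M) : Prop where
  isOpen : IsOpen U
  smooth : ∀ a, SmoothOn (e a) U
  inner_eq : ∀ x ∈ U, ∀ a b, g.inner (e a) (e b) x = nullEta d a b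
  aligned : ∀ x ∈ U, ∃ c : ℝ, e 0 x = c • ℓ x

/-- The frame is parallelly transported along `m₀`, which is therefore geodesic and affinely
parameterized. -/
def IsParallelFrame (U : Set M) (e : Fin (d + 2) → VField d M) : Prop :=
  ∀ x ∈ U, ∀ a, g.nabla (e 0) (e a) x = 0

/-- The Ricci rotation coefficients `L_{ab} = g(∇_{m_b} m₀, m_a)` of a frame. -/
def rotL (e : Fin (d + 2) → VField d M) (a b : Fin (d + 2)) : M → ℝ :=
  g.inner (g.nabla (e b) (e 0)) (e a)

/-- `ℓ` is a Kundt null vector field: smooth, null, nowhere zero, with `L_{i0} = 0 = L_{ij}`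
(`i, j ≥ 2`), i.e. geodesic, non-expanding, shear-free and twist-free. -/
structure IsKundt (ℓ : VField d M) : Prop where
  smooth : SmoothOn ℓ Set.univ
  ne_zero : ∀ x, ℓ x ≠ 0
  null : ∀ x, g.inner ℓ ℓ x = 0
  geodesic : ∀ (U : Set M) (e : Fin (d + 2) → VField d M), g.IsAdaptedFrame ℓ U e →
    ∀ x ∈ U, ∀ i, i ≠ 0 → i ≠ 1 → g.rotL e i 0 x = 0
  optical : ∀ (U : Set M) (e : Fin (d + 2) → VField d M), g.IsAdaptedFrame ℓ U e →
    ∀ x ∈ U, ∀ i j, i ≠ 0 → i ≠ 1 → j ≠ 0 → j ≠ 1 → g.rotL e i j x = 0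

/-- The components of `T` of boost weight greater than `b` vanish in every null frame aligned with
`ℓ`. -/
def BoostOrderLE (ℓ : VField d M) {k : ℕ} (T : TensorField d M k) (b : ℤ) : Prop :=
  ∀ (U : Set M) (e : Fin (d + 2) → VField d M), g.IsAdaptedFrame ℓ U e →
    ∀ x ∈ U, ∀ a : Fin k → Fin (d + 2), b < boostWeight a → T (fun j => e (a j)) x = 0

/-- `T` is of type II, or more special, aligned with `ℓ`: no components of positive boost
weight. -/
def IsAlignedTypeII (ℓ : VField d M) {k : ℕ} (T : TensorField d M k) : Prop :=
  g.BoostOrderLE ℓ T 0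

/-- `T` is of type III, or more special, aligned with `ℓ`: only components of negative boost
weight. -/
def IsAlignedTypeIII (ℓ : VField d M) {k : ℕ} (T : TensorField d M k) : Prop :=
  g.BoostOrderLE ℓ T (-1)

/-- `ℓ` is a degenerate Kundt null vector field: its direction is also a multiple null direction of
the Riemann tensor and of its covariant derivatives of arbitrary order. -/
def IsDegenerateKundt (ℓ : VField d M) : Prop :=
  g.IsKundt ℓ ∧ ∀ I : ℕ, g.IsAlignedTypeII ℓ (g.iterCovDeriv g.riemann I)

/-- `η` is a balanced scalar of boost weight `b` on `U`, with `D` the derivative along `m`: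
`η = 0` if `b ≥ 0`, and `D^{-b} η = 0` if `b < 0`. -/
def IsBalancedScalar (m : VField d M) (U : Set M) (b : ℤ) (η : M → ℝ) : Prop :=
  (0 ≤ b → ∀ x ∈ U, η x = 0) ∧ (b < 0 → ∀ x ∈ U, ((dirDeriv m)^[(-b).toNat] η) x = 0)

/-- `T` is a balanced tensor with respect to the null direction of `ℓ`: in every null frame aligned
with `ℓ` and parallelly transported along the (affinely parameterized geodesic) vector field `m₀`,
all the components of `T` are balanced scalars. -/
def IsBalanced (ℓ : VField d M) {k : ℕ} (T : TensorField d M k) : Prop :=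
  ∀ (U : Set M) (e : Fin (d + 2) → VField d M), g.IsAdaptedFrame ℓ U e → g.IsParallelFrame U e →
    ∀ a : Fin k → Fin (d + 2), IsBalancedScalar (e 0) U (boostWeight a) (T (fun j => e (a j)))

end LorentzMetric

end Kundt

end

/-!
All statements concern the components of tensors in a null frame on an open set `U`, so they can be
read as statements about the ring `smoothRing d U` of smooth functions on `U`, with one derivation
for each frame vector and with the matrices of the connection (`FrameConnection`). The bridge to
the manifold is `LorentzMetric.IsAdaptedFrame.HasComp`: the Riemann tensor and its covariant
derivatives have the components that the algebra predicts (`hasComp_riemann`,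
`HasComp.iterCovDeriv`). The commutator formula for the frame derivations and the Jacobi identity
come from the Lie bracket of vector fields, and the Christoffel symbols from the Koszul formula.

Write `D` for the derivative along `m₀ = e 0`. If the Weyl tensor and the tracefree Ricci tensor are
of type III, the Riemann tensor is `f (g ∧ g) + Z` with `Z` of type III
(`exists_isCurvatureTypeIII`). The Kundt condition says that covariant differentiation along `e c`
never raises the boost weight, except that for `c = 1` it may do so by one, which the new index `1`
compensates. So `∇` could raise the boost order only by the new index in `∇₀`.

The second Bianchi identity gives `D f = 0` and `eᵢ f = 0` for the transverse `eᵢ`, so that `f`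
contributes to `∇ Riem` only in negative boost weight. That `∇^(I) Riem` is of type III for all
`I ≥ 1` goes by induction on `I` (`IsCurvatureTypeIII.boostLE_succ`). Consider a component of
nonnegative boost weight. If its first index is not `0`, it vanishes by what was said. If one of the
other derivative indices is not `0`, the Ricci identity moves the first such index to the front,
past one `0` at a time. Each exchange costs a term `D^m (Riem * ∇^(r) Riem)` of order
`m + r + 2 = I + 1`. By the induction hypothesis each of these derivatives `D` lowers the boost order by one, because an
index `0` of a tensor of type III is paid for by its other indices (`DerBoostLE`), and so the term
has too low a boost order to contribute (`IsCurvatureTypeIII.boostLE_curvAct`); for `r = 0` it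
matters that `f (g ∧ g)` acts trivially on the curvature. If all derivative indices are `0`, the
second Bianchi identity exchanges the last of them for two indices of the curvature, which leads
back to the case already treated.

That the tensors are balanced then needs no further work: in a frame that is parallel along `m₀`,
`D^k` of a component of `∇^(I) Riem` of boost weight `-k` is a component of `∇^(I+k) Riem` of boost
weight zero, and this tensor is of type III.
-/

noncomputable section

namespace Kundt

/-! ### Components with respect to a null frame -/

/-- The involution of the frame indices that exchanges the two null directions; as `nullEta` is the
permutation matrix of `conj`, raising or lowering an index `a` amounts to replacing it
by `conj a`. -/
def conj {d : ℕ} : Equiv.Perm (Fin (d + 2)) := Equiv.swap 0 1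

/-- The boost weight of a single covariant index. -/
def wt {d : ℕ} (a : Fin (d + 2)) : ℤ := if a = 0 then 1 else if a = 1 then -1 else 0

/-- The boost weight of a list of covariant indices. -/
def listWt {d : ℕ} (l : List (Fin (d + 2))) : ℤ := (l.map wt).sum

section Index

variable {d : ℕ}

@[simp] lemma conj_conj (a : Fin (d + 2)) : conj (conj a) = a := Equiv.swap_apply_self _ _ _

@[simp] lemma conj_zero : conj (0 : Fin (d + 2)) = 1 := Equiv.swap_apply_left _ _

@[simp] lemma conj_one : conj (1 : Fin (d + 2)) = 0 := Equiv.swap_apply_right _ _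

lemma conj_of_ne {a : Fin (d + 2)} (h0 : a ≠ 0) (h1 : a ≠ 1) : conj a = a :=
  Equiv.swap_apply_of_ne_of_ne h0 h1

lemma eq_conj_comm {a b : Fin (d + 2)} : a = conj b ↔ b = conj a :=
  ⟨fun h => by rw [h, conj_conj], fun h => by rw [h, conj_conj]⟩

@[simp] lemma wt_zero : wt (0 : Fin (d + 2)) = 1 := rfl

@[simp] lemma wt_one : wt (1 : Fin (d + 2)) = -1 := by simp [wt]

lemma wt_of_ne {a : Fin (d + 2)} (h0 : a ≠ 0) (h1 : a ≠ 1) : wt a = 0 := by simp [wt, h0, h1]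

lemma neg_one_le_wt (a : Fin (d + 2)) : -1 ≤ wt a := by unfold wt; split_ifs <;> omega

lemma wt_le_zero {a : Fin (d + 2)} (h : a ≠ 0) : wt a ≤ 0 := by
  unfold wt; split_ifs <;> omega

@[simp] lemma wt_conj (a : Fin (d + 2)) : wt (conj a) = -wt a := by
  by_cases h0 : a = 0
  · simp [h0]
  by_cases h1 : a = 1
  · simp [h1]
  simp [conj_of_ne h0 h1, wt_of_ne h0 h1]

@[simp] lemma listWt_nil : listWt ([] : List (Fin (d + 2))) = 0 := rfl

@[simp] lemma listWt_cons (a : Fin (d + 2)) (l : List (Fin (d + 2))) :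
    listWt (a :: l) = wt a + listWt l := rfl

@[simp] lemma listWt_append (l l' : List (Fin (d + 2))) :
    listWt (l ++ l') = listWt l + listWt l' := by
  induction l with
  | nil => simp
  | cons a l ih => simp [ih, add_assoc]

@[simp] lemma listWt_replicate_zero (n : ℕ) : listWt (List.replicate n (0 : Fin (d + 2))) = n := by
  induction n with
  | zero => simp
  | succ n ih => simp [List.replicate_succ, ih, add_comm]

lemma nullEta_eq (a b : Fin (d + 2)) : nullEta d a b = if b = conj a then 1 else 0 := by
  unfold nullEta
  by_cases h0 : a = 0
  · simp [h0]
  by_cases h1 : a = 1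
  · simp [h1]
  simp [h0, h1, conj_of_ne h0 h1, eq_comm]

end Index

section Action

variable {d : ℕ} {A : Type*} [CommRing A]

/-- The components of a covariant tensor in a frame, as a function of the list of indices; for a
tensor of rank `k` only lists of length `k` are relevant. Lists make it possible to handle tensors
of all ranks without casts between types. -/
abbrev Comp (d : ℕ) (A : Type*) : Type _ := List (Fin (d + 2)) → A

/-- A matrix acting as a derivation of the tensor algebra: it is applied to each index in turn. -/
def act (m : Matrix (Fin (d + 2)) (Fin (d + 2)) A) : List (Fin (d + 2)) → Comp d A → A
  | [], _ => 0
  | a :: l, T => ∑ b, m a b * T (b :: l) + act m l (fun l' => T (a :: l'))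

variable (m n : Matrix (Fin (d + 2)) (Fin (d + 2)) A) (l : List (Fin (d + 2)))

@[simp] lemma act_nil (T : Comp d A) : act m [] T = 0 := rfl

lemma act_cons (a : Fin (d + 2)) (T : Comp d A) :
    act m (a :: l) T = ∑ b, m a b * T (b :: l) + act m l (fun l' => T (a :: l')) := rfl

lemma act_add (S T : Comp d A) : act m l (fun l' => S l' + T l') = act m l S + act m l T := by
  induction l generalizing S T with
  | nil => simp
  | cons a l ih => simp only [act_cons, ih, mul_add, Finset.sum_add_distrib]; ring

lemma act_mul (f : A) (T : Comp d A) : act m l (fun l' => f * T l') = f * act m l T := by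
  induction l generalizing T with
  | nil => simp
  | cons a l ih =>
    simp only [act_cons, ih, mul_add, Finset.mul_sum]
    congr 1
    exact Finset.sum_congr rfl fun b _ => by ring

lemma act_sub (S T : Comp d A) : act m l (fun l' => S l' - T l') = act m l S - act m l T := by
  have h := act_add m l S (fun l' => (-1) * T l')
  rw [act_mul] at h
  simpa [sub_eq_add_neg] using h

lemma act_sum {κ : Type*} (s : Finset κ) (T : κ → Comp d A) :
    act m l (fun l' => ∑ k ∈ s, T k l') = ∑ k ∈ s, act m l (T k) := by
  classical
  induction s using Finset.induction_on with
  | empty => simpa using act_mul m l 0 (fun _ => 0)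
  | insert k s hk ih => simp only [Finset.sum_insert hk, act_add, ih]

lemma add_act (T : Comp d A) : act (m + n) l T = act m l T + act n l T := by
  induction l generalizing T with
  | nil => simp
  | cons a l ih =>
    simp only [act_cons, ih, Matrix.add_apply, add_mul, Finset.sum_add_distrib]; ring

lemma smul_act (f : A) (T : Comp d A) : act (f • m) l T = f * act m l T := by
  induction l generalizing T with
  | nil => simp
  | cons a l ih =>
    simp only [act_cons, ih, Matrix.smul_apply, smul_eq_mul, mul_add, Finset.mul_sum, mul_assoc]

lemma sub_act (T : Comp d A) : act (m - n) l T = act m l T - act n l T := by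
  have h := add_act m ((-1 : A) • n) l T
  rw [smul_act] at h
  simpa [sub_eq_add_neg] using h

lemma sum_act {κ : Type*} (s : Finset κ) (m : κ → Matrix (Fin (d + 2)) (Fin (d + 2)) A)
    (T : Comp d A) : act (∑ k ∈ s, m k) l T = ∑ k ∈ s, act (m k) l T := by
  classical
  induction s using Finset.induction_on with
  | empty => simpa using smul_act 0 l 0 T
  | insert k s hk ih => simp only [Finset.sum_insert hk, add_act, ih]

/-- The commutator of two derivations is the derivation given by the commutator of the matrices. -/
lemma act_act_sub (T : Comp d A) :
    act m l (fun l' => act n l' T) - act n l (fun l' => act m l' T) = act (m * n - n * m) l T := by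
  induction l generalizing T with
  | nil => simp
  | cons a l ih =>
    have key : ∀ m n : Matrix (Fin (d + 2)) (Fin (d + 2)) A,
        act m (a :: l) (fun l' => act n l' T)
          = ∑ c, (m * n) a c * T (c :: l) + ∑ b, m a b * act n l (fun l' => T (b :: l'))
            + ∑ b, n a b * act m l (fun l' => T (b :: l'))
            + act m l (fun l' => act n l' (fun l'' => T (a :: l''))) := by
      intro m n
      simp only [act_cons, act_add, act_sum, act_mul, mul_add, Finset.sum_add_distrib,
        Matrix.mul_apply, Finset.mul_sum, Finset.sum_mul]
      rw [Finset.sum_comm]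
      simp only [mul_assoc]
      ring
    rw [key m n, key n m, act_cons, ← ih]
    simp only [Matrix.sub_apply, sub_mul, Finset.sum_sub_distrib]
    ring

variable [Algebra ℝ A] in
lemma derivation_act (D : Derivation ℝ A A) (T : Comp d A) :
    D (act m l T) = act (m.map D) l T + act m l (fun l' => D (T l')) := by
  induction l generalizing T with
  | nil => simp
  | cons a l ih =>
    simp only [act_cons, map_add, map_sum, ih, Derivation.leibniz, smul_eq_mul, Matrix.map_apply,
      Finset.sum_add_distrib]
    have : ∑ b, T (b :: l) * D (m a b) = ∑ b, D (m a b) * T (b :: l) :=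
      Finset.sum_congr rfl fun b _ => mul_comm _ _
    rw [this]; ring

/-- `m` is skew with respect to the metric, that is, lies in the Lorentz Lie algebra. -/
def IsSkew (m : Matrix (Fin (d + 2)) (Fin (d + 2)) A) : Prop := ∀ a b, m a (conj b) = -m b (conj a)

lemma sum_conj (f : Fin (d + 2) → A) : ∑ b, f (conj b) = ∑ b, f b := Equiv.sum_comp conj f

variable {m n}

lemma IsSkew.sub (hm : IsSkew m) (hn : IsSkew n) : IsSkew (m - n) := fun a b => by
  simp only [Matrix.sub_apply, hm a b, hn a b]; ring

lemma IsSkew.smul (f : A) (hm : IsSkew m) : IsSkew (f • m) := fun a b => by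
  simp [hm a b]

lemma IsSkew.sum {κ : Type*} (s : Finset κ) (m : κ → Matrix (Fin (d + 2)) (Fin (d + 2)) A)
    (h : ∀ k, IsSkew (m k)) : IsSkew (∑ k ∈ s, m k) := fun a b => by
  simp only [Matrix.sum_apply, ← Finset.sum_neg_distrib]
  exact Finset.sum_congr rfl fun k _ => h k a b

variable [Algebra ℝ A] in
lemma IsSkew.map (D : Derivation ℝ A A) (hm : IsSkew m) : IsSkew (m.map D) := fun a b => by
  simp [hm a b]

lemma IsSkew.mul_conj (hm : IsSkew m) (hn : IsSkew n) (a b : Fin (d + 2)) :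
    (m * n) a (conj b) = (n * m) b (conj a) := by
  simp only [Matrix.mul_apply]
  rw [← sum_conj]
  refine Finset.sum_congr rfl fun f _ => ?_
  have h := hn (conj f) b
  rw [conj_conj] at h
  rw [hm a f, h]; ring

lemma IsSkew.commutator (hm : IsSkew m) (hn : IsSkew n) : IsSkew (m * n - n * m) := fun a b => by
  rw [Matrix.sub_apply, Matrix.sub_apply, hm.mul_conj hn a b, hn.mul_conj hm a b]; ring

/-- The components of the metric. -/
def eta (a b : Fin (d + 2)) : A := if b = conj a then 1 else 0

lemma eta_comm (a b : Fin (d + 2)) : (eta a b : A) = eta b a := by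
  simp [eta, eq_conj_comm]

lemma eta_eq_zero {a b : Fin (d + 2)} (h : wt a + wt b ≠ 0) : (eta a b : A) = 0 := by
  refine if_neg fun h' => h ?_
  rw [h', wt_conj]; ring

lemma sum_mul_eta (f : Fin (d + 2) → A) (a : Fin (d + 2)) : ∑ b, f b * eta b a = f (conj a) := by
  simp [eta, eq_conj_comm]

/-- The algebraic curvature tensor `g_{ac} g_{bd} - g_{ad} g_{bc}` of constant curvature. -/
def metricWedge : Comp d A
  | [a, b, p, q] => eta a p * eta b q - eta a q * eta b p
  | _ => 0

lemma metricWedge_eq_zero_of_length {l : List (Fin (d + 2))} (h : l.length ≠ 4) :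
    (metricWedge l : A) = 0 := by
  unfold metricWedge
  split
  · simp at h
  · rfl

lemma act_eq_zero_of_length {l : List (Fin (d + 2))} {T : Comp d A}
    (h : ∀ l', l'.length = l.length → T l' = 0) : act m l T = 0 := by
  induction l generalizing T with
  | nil => rfl
  | cons a l ih =>
    rw [act_cons, ih fun l' hl' => h _ (by simp [hl']), Finset.sum_eq_zero fun b _ => ?_, add_zero]
    rw [h _ (by simp), mul_zero]

lemma act_metricWedge (hm : IsSkew m) (l : List (Fin (d + 2))) :
    act m l (metricWedge : Comp d A) = 0 := by
  by_cases hl : l.length = 4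
  · obtain ⟨a, b, p, q, rfl⟩ := List.length_eq_four.1 hl
    have key : ∀ (x y z : Fin (d + 2)) (c c' : A),
        ∑ f, m x f * (eta f y * c - eta f z * c') = m x (conj y) * c - m x (conj z) * c' := by
      intro x y z c c'
      rw [← sum_mul_eta (m x) y, ← sum_mul_eta (m x) z, Finset.sum_mul, Finset.sum_mul,
        ← Finset.sum_sub_distrib]
      exact Finset.sum_congr rfl fun f _ => by ring
    simp only [act_cons, act_nil, metricWedge]
    rw [key a p q (eta b q) (eta b p)]
    have h1 := key b q p (eta a p) (eta a q)
    have h2 := key p a b (eta b q) (eta a q)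
    have h3 := key q b a (eta a p) (eta b p)
    rw [Finset.sum_congr rfl fun f _ => show m b f * (eta a p * eta f q - eta a q * eta f p)
      = m b f * (eta f q * eta a p - eta f p * eta a q) by ring, h1]
    rw [Finset.sum_congr rfl fun f _ => show m p f * (eta a f * eta b q - eta a q * eta b f)
      = m p f * (eta f a * eta b q - eta f b * eta a q) by
        rw [eta_comm a f, eta_comm b f]; ring, h2]
    rw [Finset.sum_congr rfl fun f _ => show m q f * (eta a p * eta b f - eta a f * eta b p)
      = m q f * (eta f b * eta a p - eta f a * eta b p) by
        rw [eta_comm a f, eta_comm b f]; ring, h3]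
    rw [hm p a, hm p b, hm q a, hm q b]; ring
  · exact act_eq_zero_of_length fun l' hl' => metricWedge_eq_zero_of_length (by rwa [hl'])

end Action

/-! ### The Levi-Civita connection in a null frame -/

/-- The Levi-Civita connection of a Lorentzian metric in a null frame `e`, over an abstract ring `A`
of scalar functions: `der a` is the derivative along `e a`, and
`∇_{e c} e_a = ∑ b, conn c a b • e b`. The axioms express that the connection is metric
(`skew`), that it is torsion-free, so that the bracket of `e p` and `e q` has the components
`conn p q - conn q p` (`comm`), and the Jacobi identity of the brackets (`jacobi`). -/
structure FrameConnection (d : ℕ) (A : Type*) [CommRing A] [Algebra ℝ A] where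
  der : Fin (d + 2) → Derivation ℝ A A
  conn : Fin (d + 2) → Matrix (Fin (d + 2)) (Fin (d + 2)) A
  skew : ∀ c, IsSkew (conn c)
  comm : ∀ p q f, der p (der q f) - der q (der p f) = ∑ c, (conn p q c - conn q p c) * der c f
  jacobi : ∀ p q r s,
    (der p (conn q r s - conn r q s) + ∑ f, (conn q r f - conn r q f) * (conn p f s - conn f p s))
    + (der q (conn r p s - conn p r s) + ∑ f, (conn r p f - conn p r f) * (conn q f s - conn f q s))
    + (der r (conn p q s - conn q p s) + ∑ f, (conn p q f - conn q p f) * (conn r f s - conn f r s))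
    = 0

namespace FrameConnection

variable {d : ℕ} {A : Type*} [CommRing A] [Algebra ℝ A] (F : FrameConnection d A)

/-- The frame components of `∇_{e c} T`. -/
def nab (c : Fin (d + 2)) (T : Comp d A) : Comp d A := fun l => F.der c (T l) - act (F.conn c) l T

/-- The frame components of `∇ T`, the derivative index being put first. -/
def grad (T : Comp d A) : Comp d A
  | [] => 0
  | c :: l => F.nab c T l

lemma grad_cons (T : Comp d A) (c : Fin (d + 2)) (l : List (Fin (d + 2))) :
    F.grad T (c :: l) = F.nab c T l := rfl

lemma nab_cons (c a : Fin (d + 2)) (T : Comp d A) (l : List (Fin (d + 2))) :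
    F.nab c T (a :: l) = F.nab c (fun l' => T (a :: l')) l - ∑ b, F.conn c a b * T (b :: l) := by
  simp only [nab, act_cons]; ring

lemma nab_add (c : Fin (d + 2)) (S T : Comp d A) (l : List (Fin (d + 2))) :
    F.nab c (fun l' => S l' + T l') l = F.nab c S l + F.nab c T l := by
  simp only [nab, act_add, map_add]; ring

lemma nab_sub (c : Fin (d + 2)) (S T : Comp d A) (l : List (Fin (d + 2))) :
    F.nab c (fun l' => S l' - T l') l = F.nab c S l - F.nab c T l := by
  simp only [nab, act_sub, map_sub]; ring

lemma nab_mul (c : Fin (d + 2)) (f : A) (T : Comp d A) (l : List (Fin (d + 2))) :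
    F.nab c (fun l' => f * T l') l = F.der c f * T l + f * F.nab c T l := by
  simp only [nab, act_mul, Derivation.leibniz, smul_eq_mul]; ring

lemma nab_nab (p q : Fin (d + 2)) (T : Comp d A) (l : List (Fin (d + 2))) :
    F.nab p (F.nab q T) l = F.der p (F.der q (T l)) - act ((F.conn q).map (F.der p)) l T
      - act (F.conn q) l (fun l' => F.der p (T l')) - act (F.conn p) l (fun l' => F.der q (T l'))
      + act (F.conn p) l (fun l' => act (F.conn q) l' T) := by
  have : F.nab q T = fun l' => F.der q (T l') - act (F.conn q) l' T := rfl
  rw [this, nab_sub]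
  simp only [nab, derivation_act]; ring

/-! ### Curvature, the Ricci identity and the Bianchi identities -/

/-- The matrix of the curvature operator: `R(e_p, e_q) e_a = ∑ b, curv p q a b • e b`. -/
def curv (p q : Fin (d + 2)) : Matrix (Fin (d + 2)) (Fin (d + 2)) A :=
  (F.conn q).map (F.der p) - (F.conn p).map (F.der q)
    - (F.conn p * F.conn q - F.conn q * F.conn p) - ∑ c, (F.conn p q c - F.conn q p c) • F.conn c

/-- The components of the Riemann tensor, `R_{abpq} = g(R(e_p, e_q) e_b, e_a)`. -/
def riem : Comp d A
  | [a, b, p, q] => F.curv p q b (conj a)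
  | _ => 0

/-- The matrices `Q_{·,·,p,q}` of a tensor of rank four, with the first index raised. -/
def rankFourMat (Q : Comp d A) (p q : Fin (d + 2)) : Matrix (Fin (d + 2)) (Fin (d + 2)) A :=
  fun a b => Q [conj b, a, p, q]

/-- The action `(Q · S)_{pq…}` of the endomorphisms `Q_{pq}` on the tensor `S`. -/
def curvAct (Q S : Comp d A) : Comp d A
  | p :: q :: l => act (rankFourMat Q p q) l S
  | _ => 0

lemma rankFourMat_riem (p q : Fin (d + 2)) : rankFourMat F.riem p q = F.curv p q := by
  ext a b; simp [rankFourMat, riem]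

lemma curv_swap (p q : Fin (d + 2)) : F.curv q p = -F.curv p q := by
  have : ∑ c, (F.conn q p c - F.conn p q c) • F.conn c
      = -∑ c, (F.conn p q c - F.conn q p c) • F.conn c := by
    rw [← Finset.sum_neg_distrib]
    exact Finset.sum_congr rfl fun c _ => by rw [← neg_smul, neg_sub]
  rw [curv, curv, this]; abel

lemma curv_skew (p q : Fin (d + 2)) : IsSkew (F.curv p q) :=
  ((((F.skew q).map _).sub ((F.skew p).map _)).sub ((F.skew p).commutator (F.skew q))).sub
    (IsSkew.sum _ _ fun c => (F.skew c).smul _)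

lemma nab_nab_sub (p q : Fin (d + 2)) (T : Comp d A) (l : List (Fin (d + 2))) :
    F.nab p (F.nab q T) l - F.nab q (F.nab p T) l
      = ∑ c, (F.conn p q c - F.conn q p c) * F.nab c T l - act (F.curv p q) l T := by
  have h := act_act_sub (F.conn p) (F.conn q) l T
  have hc := F.comm p q (T l)
  have e : ∑ c, (F.conn p q c - F.conn q p c) * F.nab c T l
      = ∑ c, (F.conn p q c - F.conn q p c) * F.der c (T l)
        - ∑ c, (F.conn p q c - F.conn q p c) * act (F.conn c) l T := by
    simp only [nab, mul_sub, Finset.sum_sub_distrib]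
  rw [nab_nab, nab_nab, curv, sub_act, sub_act, sub_act, sum_act, e, ← hc, ← h]
  simp only [smul_act]; ring

/-- The Ricci identity. -/
lemma grad_grad_sub (p q : Fin (d + 2)) (T : Comp d A) (l : List (Fin (d + 2))) :
    F.grad (F.grad T) (p :: q :: l) - F.grad (F.grad T) (q :: p :: l)
      = -curvAct F.riem T (p :: q :: l) := by
  have h := F.nab_nab_sub p q T l
  have e : ∀ p q, F.grad (F.grad T) (p :: q :: l)
      = F.nab p (F.nab q T) l - ∑ c, F.conn p q c * F.nab c T l := fun p q => by
    rw [grad_cons, nab_cons]; rfl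
  simp only [sub_mul, Finset.sum_sub_distrib] at h
  rw [e, e, curvAct, rankFourMat_riem]
  linear_combination h

lemma curv_bianchi (p q r s : Fin (d + 2)) :
    F.curv p q r s + F.curv q r p s + F.curv r p q s = 0 := by
  have h := F.jacobi p q r s
  simp only [curv, Matrix.sub_apply, Matrix.sum_apply, Matrix.smul_apply, Matrix.map_apply,
    Matrix.mul_apply, smul_eq_mul, sub_mul, mul_sub, Finset.sum_sub_distrib, map_sub] at h ⊢
  linear_combination h

lemma riem_swap_right (a b p q : Fin (d + 2)) : F.riem [a, b, q, p] = -F.riem [a, b, p, q] := by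
  simp [riem, F.curv_swap p q]

lemma riem_swap_left (a b p q : Fin (d + 2)) : F.riem [b, a, p, q] = -F.riem [a, b, p, q] := by
  simp [riem, F.curv_skew p q b a]

lemma riem_swap_both (a b p q : Fin (d + 2)) : F.riem [b, a, q, p] = F.riem [a, b, p, q] := by
  rw [riem_swap_left, riem_swap_right, neg_neg]

lemma riem_cyclic (a b p q : Fin (d + 2)) :
    F.riem [a, b, p, q] + F.riem [a, p, q, b] + F.riem [a, q, b, p] = 0 := by
  have h := F.curv_bianchi p q b (conj a)
  simp only [riem]; linear_combination h

lemma eq_zero_of_two_mul {x : A} (h : 2 * x = 0) : x = 0 := by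
  have h2 : (2 : ℝ) • x = 0 := by rw [Algebra.smul_def, map_ofNat, h]
  simpa using congrArg (fun y => (2⁻¹ : ℝ) • y) h2

lemma riem_pair (a b p q : Fin (d + 2)) : F.riem [a, b, p, q] = F.riem [p, q, a, b] := by
  rw [← sub_eq_zero]
  refine eq_zero_of_two_mul ?_
  have h1 := F.riem_cyclic a b p q
  have h2 := F.riem_cyclic b a q p
  have h3 := F.riem_cyclic p q a b
  have h4 := F.riem_cyclic q p b a
  rw [F.riem_swap_both, F.riem_swap_both q b] at h2
  rw [F.riem_swap_both a p, F.riem_swap_both b p] at h3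
  rw [F.riem_swap_both p q, F.riem_swap_both a q] at h4
  linear_combination h1 + h2 - h3 - h4

lemma nab_rank_four (c a b p q : Fin (d + 2)) (T : Comp d A) :
    F.nab c T [a, b, p, q] = F.der c (T [a, b, p, q]) - (∑ f, F.conn c a f * T [f, b, p, q]
      + ∑ f, F.conn c b f * T [a, f, p, q] + ∑ f, F.conn c p f * T [a, b, f, q]
      + ∑ f, F.conn c q f * T [a, b, p, f]) := by
  simp only [nab, act_cons, act_nil]; ring

lemma nab_act (c : Fin (d + 2)) (m : Matrix (Fin (d + 2)) (Fin (d + 2)) A) (S : Comp d A)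
    (l : List (Fin (d + 2))) :
    F.nab c (fun l' => act m l' S) l
      = act (m.map (F.der c) - (F.conn c * m - m * F.conn c)) l S + act m l (F.nab c S) := by
  have h := act_act_sub (F.conn c) m l S
  have e : act m l (F.nab c S)
      = act m l (fun l' => F.der c (S l')) - act m l (fun l' => act (F.conn c) l' S) :=
    act_sub _ _ _ _
  rw [e, sub_act, ← h]
  simp only [nab, derivation_act]; ring

lemma rankFourMat_nab (c p q : Fin (d + 2)) (Q : Comp d A) :
    rankFourMat (F.nab c Q) p q = (rankFourMat Q p q).map (F.der c)
      - (F.conn c * rankFourMat Q p q - rankFourMat Q p q * F.conn c)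
      - ∑ f, F.conn c p f • rankFourMat Q f q - ∑ f, F.conn c q f • rankFourMat Q p f := by
  ext a b
  simp only [rankFourMat, nab_rank_four, Matrix.sub_apply, Matrix.sum_apply, Matrix.smul_apply,
    Matrix.map_apply, Matrix.mul_apply, smul_eq_mul]
  have : ∑ f, F.conn c (conj b) f * Q [f, a, p, q]
      = -∑ f, Q [conj f, a, p, q] * F.conn c f b := by
    rw [← sum_conj, ← Finset.sum_neg_distrib]
    refine Finset.sum_congr rfl fun f _ => ?_
    rw [F.skew c (conj b) f, conj_conj]; ring
  rw [this]; ring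

/-- The action of rank four tensors on tensors is parallel. -/
lemma nab_curvAct (c : Fin (d + 2)) (Q S : Comp d A) (l : List (Fin (d + 2))) :
    F.nab c (curvAct Q S) l = curvAct (F.nab c Q) S l + curvAct Q (F.nab c S) l := by
  match l with
  | [] => simp [nab, curvAct]
  | [_] => simp [nab, curvAct, act_cons]
  | p :: q :: l =>
    have h : F.nab c (curvAct Q S) (p :: q :: l)
      = F.nab c (fun l' => act (rankFourMat Q p q) l' S) l
        - ∑ f, F.conn c q f * act (rankFourMat Q p f) l S
        - ∑ f, F.conn c p f * act (rankFourMat Q f q) l S := by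
      rw [nab_cons, nab_cons]; rfl
    rw [h, nab_act]
    simp only [curvAct, rankFourMat_nab, sub_act, sum_act, smul_act]
    ring

/-- If `-W` is the antisymmetrization of `Y` in its first two indices, the same holds for their
covariant derivatives. -/
lemma nab_antisymm {Y W : Comp d A}
    (h : ∀ p q l, Y (p :: q :: l) - Y (q :: p :: l) = -W (p :: q :: l)) (c p q : Fin (d + 2))
    (l : List (Fin (d + 2))) :
    F.nab c Y (p :: q :: l) - F.nab c Y (q :: p :: l) = -F.nab c W (p :: q :: l) := by
  have e : ∀ (T : Comp d A) (p q : Fin (d + 2)), F.nab c T (p :: q :: l)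
      = F.nab c (fun l' => T (p :: q :: l')) l - ∑ f, F.conn c q f * T (p :: f :: l)
        - ∑ f, F.conn c p f * T (f :: q :: l) := fun T p q => by rw [nab_cons, nab_cons]
  have hW : (fun l' => W (p :: q :: l')) = fun l' => Y (q :: p :: l') - Y (p :: q :: l') :=
    funext fun l' => by linear_combination h p q l'
  have h' : ∀ p q l, W (p :: q :: l) = Y (q :: p :: l) - Y (p :: q :: l) :=
    fun p q l => by linear_combination h p q l
  rw [e Y, e Y, e W, hW, nab_sub]
  simp only [h', mul_sub, Finset.sum_sub_distrib]
  ring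

/-- The operator form of the second Bianchi identity. -/
lemma curvAct_nab_riem_cyclic (T : Comp d A) (m p q : Fin (d + 2)) (l : List (Fin (d + 2))) :
    curvAct (F.nab m F.riem) T (p :: q :: l) + curvAct (F.nab p F.riem) T (q :: m :: l)
      + curvAct (F.nab q F.riem) T (m :: p :: l) = 0 := by
  -- antisymmetrize the third derivative of `T` in the last two, or in the first two, derivatives
  have h1 : ∀ m p q, F.grad (F.grad (F.grad T)) (m :: p :: q :: l)
      - F.grad (F.grad (F.grad T)) (m :: q :: p :: l)
        = -(curvAct (F.nab m F.riem) T (p :: q :: l)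
          + curvAct F.riem (F.nab m T) (p :: q :: l)) := by
    intro m p q
    rw [grad_cons, grad_cons, F.nab_antisymm (fun p q l => F.grad_grad_sub p q T l) m p q l,
      nab_curvAct]
  have h2 : ∀ m p q, F.grad (F.grad (F.grad T)) (m :: p :: q :: l)
      - F.grad (F.grad (F.grad T)) (p :: m :: q :: l)
        = -(∑ f, F.curv m p q f * F.nab f T l + curvAct F.riem (F.nab q T) (m :: p :: l)) := by
    intro m p q
    rw [F.grad_grad_sub m p (F.grad T) (q :: l), curvAct, curvAct, act_cons, rankFourMat_riem]
    rfl
  have h3 : ∑ f, F.curv m p q f * F.nab f T l + ∑ f, F.curv p q m f * F.nab f T l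
      + ∑ f, F.curv q m p f * F.nab f T l = 0 := by
    rw [← Finset.sum_add_distrib, ← Finset.sum_add_distrib]
    refine Finset.sum_eq_zero fun f _ => ?_
    rw [← add_mul, ← add_mul, F.curv_bianchi, zero_mul]
  linear_combination h1 m p q + h1 p q m + h1 q m p - h2 m p q - h2 p q m - h2 q m p + h3

/-- The second Bianchi identity. -/
lemma grad_riem_cyclic (m a b p q : Fin (d + 2)) :
    F.grad F.riem [m, a, b, p, q] + F.grad F.riem [p, a, b, q, m] + F.grad F.riem [q, a, b, m, p]
      = 0 := by
  -- a covector with the single component `conj a` reads off the matrix entries of the operators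
  have h := F.curvAct_nab_riem_cyclic (fun l => if l = [conj a] then 1 else 0) m p q [b]
  simpa [curvAct, act_cons, rankFourMat, grad_cons] using h

lemma sum_conn_mul_congr (c a : Fin (d + 2)) {y z : Fin (d + 2) → A} (h : ∀ f, y f = z f) :
    ∑ f, F.conn c a f * y f = ∑ f, F.conn c a f * z f :=
  Finset.sum_congr rfl fun f _ => by rw [h f]

lemma nab_riem_pair (c a b p q : Fin (d + 2)) :
    F.nab c F.riem [a, b, p, q] = F.nab c F.riem [p, q, a, b] := by
  simp only [nab_rank_four]
  linear_combination congrArg (F.der c) (F.riem_pair a b p q)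
    - F.sum_conn_mul_congr c a (fun f => F.riem_pair f b p q)
    - F.sum_conn_mul_congr c b (fun f => F.riem_pair a f p q)
    - F.sum_conn_mul_congr c p (fun f => F.riem_pair a b f q)
    - F.sum_conn_mul_congr c q (fun f => F.riem_pair a b p f)

lemma nab_rank_five (c m a b p q : Fin (d + 2)) (T : Comp d A) :
    F.nab c T [m, a, b, p, q] = F.der c (T [m, a, b, p, q])
      - (∑ f, F.conn c m f * T [f, a, b, p, q] + ∑ f, F.conn c a f * T [m, f, b, p, q]
      + ∑ f, F.conn c b f * T [m, a, f, p, q] + ∑ f, F.conn c p f * T [m, a, b, f, q]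
      + ∑ f, F.conn c q f * T [m, a, b, p, f]) := by
  simp only [nab, act_cons, act_nil]; ring

/-- The symmetries of the covariant derivative of the Riemann tensor: the pair symmetry and the
second Bianchi identity. -/
structure HasBianchiSymm (Y : Comp d A) : Prop where
  pair : ∀ m a b p q, Y [m, a, b, p, q] = Y [m, p, q, a, b]
  cyclic : ∀ m a b p q, Y [m, a, b, p, q] + Y [p, a, b, q, m] + Y [q, a, b, m, p] = 0

lemma hasBianchiSymm_grad_riem : HasBianchiSymm (F.grad F.riem) :=
  ⟨fun m => F.nab_riem_pair m, F.grad_riem_cyclic⟩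

lemma HasBianchiSymm.nab {Y : Comp d A} (h : HasBianchiSymm Y) (c : Fin (d + 2)) :
    HasBianchiSymm (F.nab c Y) := by
  constructor
  · intro m a b p q
    simp only [nab_rank_five]
    linear_combination congrArg (F.der c) (h.pair m a b p q)
      - F.sum_conn_mul_congr c m (fun f => h.pair f a b p q)
      - F.sum_conn_mul_congr c a (fun f => h.pair m f b p q)
      - F.sum_conn_mul_congr c b (fun f => h.pair m a f p q)
      - F.sum_conn_mul_congr c p (fun f => h.pair m a b f q)
      - F.sum_conn_mul_congr c q (fun f => h.pair m a b p f)
  · intro m a b p q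
    have key : ∀ (x : Fin (d + 2)) (y z w : Fin (d + 2) → A), (∀ f, y f + z f + w f = 0) →
        ∑ f, F.conn c x f * y f + ∑ f, F.conn c x f * z f + ∑ f, F.conn c x f * w f = 0 := by
      intro x y z w hf
      rw [← Finset.sum_add_distrib, ← Finset.sum_add_distrib]
      refine Finset.sum_eq_zero fun f _ => ?_
      rw [← mul_add, ← mul_add, hf, mul_zero]
    have h0 := congrArg (F.der c) (h.cyclic m a b p q)
    simp only [map_add, map_zero] at h0
    simp only [nab_rank_five]
    linear_combination h0 - key m _ _ _ (fun f => h.cyclic f a b p q)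
      - key a _ _ _ (fun f => h.cyclic m f b p q) - key b _ _ _ (fun f => h.cyclic m a f p q)
      - key p _ _ _ (fun f => h.cyclic m a b f q) - key q _ _ _ (fun f => h.cyclic m a b p f)

end FrameConnection

/-! ### Boost order in a Kundt frame -/

section Boost

variable {d : ℕ} {A : Type*} [CommRing A]

/-- All components of boost weight greater than `s` vanish. -/
def BoostLE (s : ℤ) (T : Comp d A) : Prop := ∀ l, s < listWt l → T l = 0

lemma BoostLE.mono {s t : ℤ} {T : Comp d A} (h : BoostLE s T) (hst : s ≤ t) : BoostLE t T :=
  fun l hl => h l (hst.trans_lt hl)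

/-- A matrix whose entries lower the boost weight of an index by at most `t` raises the boost order
by at most `t`. -/
lemma BoostLE.act {m : Matrix (Fin (d + 2)) (Fin (d + 2)) A} {s t : ℤ} {T : Comp d A}
    (hT : BoostLE s T) (hm : ∀ a b, wt b + t < wt a → m a b = 0) :
    BoostLE (s + t) (fun l => act m l T) := by
  intro l
  induction l generalizing s T with
  | nil => intro _; rfl
  | cons a l ih =>
    intro hl
    rw [listWt_cons] at hl
    change Kundt.act m (a :: l) T = 0
    rw [act_cons, Finset.sum_eq_zero fun b _ => ?_, zero_add]
    · refine ih (s := s - wt a) (fun l' hl' => hT _ ?_) (by linarith)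
      rw [listWt_cons]; linarith
    · by_cases hb : wt b + t < wt a
      · rw [hm a b hb, zero_mul]
      · rw [hT _ (by rw [listWt_cons]; linarith), mul_zero]

lemma BoostLE.curvAct {s t : ℤ} {Q S : Comp d A} (hQ : BoostLE s Q) (hS : BoostLE t S) :
    BoostLE (s + t) (FrameConnection.curvAct Q S) := by
  intro l hl
  match l with
  | [] | [_] => rfl
  | p :: q :: l =>
    simp only [listWt_cons] at hl
    refine hS.act (t := s - wt p - wt q) (fun a b hab => hQ _ ?_) l (by linarith)
    simp only [listWt_cons, listWt_nil, wt_conj]; linarith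

lemma boostLE_metricWedge : BoostLE 0 (metricWedge : Comp d A) := by
  intro l hl
  by_cases h : l.length = 4
  · obtain ⟨a, b, p, q, rfl⟩ := List.length_eq_four.1 h
    simp only [listWt_cons, listWt_nil] at hl
    have key : ∀ x y z w : Fin (d + 2), 0 < wt x + wt y + (wt z + wt w) →
        (eta x y : A) * eta z w = 0 := by
      intro x y z w h
      by_cases hxy : wt x + wt y = 0
      · rw [eta_eq_zero (a := z) (by omega), mul_zero]
      · rw [eta_eq_zero hxy, zero_mul]
    rw [metricWedge, key a p b q (by linarith), key a q b p (by linarith), sub_zero]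
  · exact metricWedge_eq_zero_of_length h

end Boost

namespace FrameConnection

variable {d : ℕ} {A : Type*} [CommRing A] [Algebra ℝ A] (F : FrameConnection d A)

/-- The null direction of `e 0` is geodesic, non-expanding, shear-free and twist-free. -/
def IsKundt : Prop := ∀ c i, c ≠ 1 → i ≠ 0 → i ≠ 1 → F.conn c 0 i = 0

lemma conn_zero_one (c : Fin (d + 2)) : F.conn c 0 1 = 0 := by
  refine eq_zero_of_two_mul ?_
  have h := F.skew c 0 0
  rw [conj_zero] at h
  linear_combination h

variable {F}

/-- In a Kundt frame the connection lowers the boost weight of an index only along `e 1`, and then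
by at most one. -/
lemma IsKundt.conn_eq_zero (hK : F.IsKundt) {c a b : Fin (d + 2)}
    (h : wt b + (if c = 1 then 1 else 0) < wt a) : F.conn c a b = 0 := by
  by_cases ha0 : a = 0
  · subst ha0
    by_cases hb1 : b = 1
    · rw [hb1, conn_zero_one]
    by_cases hb0 : b = 0
    · subst hb0; split_ifs at h <;> omega
    have hc : c ≠ 1 := fun hc => by simp [hc, wt_of_ne hb0 hb1] at h
    exact hK c b hc hb0 hb1
  · have hb1 : b = 1 := by
      by_contra hb1
      have : 0 ≤ wt b := by unfold wt; split_ifs <;> simp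
      have := wt_le_zero ha0
      split_ifs at h <;> omega
    subst hb1
    by_cases ha1 : a = 1
    · subst ha1; split_ifs at h <;> omega
    have hc : c ≠ 1 := fun hc => by simp [hc, wt_of_ne ha0 ha1] at h
    have := F.skew c a 0
    rwa [conj_zero, conj_of_ne ha0 ha1, hK c a hc ha0 ha1, neg_zero] at this

lemma IsKundt.conn_zero_zero (hK : F.IsKundt) {b : Fin (d + 2)} (hb : b ≠ 0) :
    F.conn 0 0 b = 0 := by
  by_cases hb1 : b = 1
  · rw [hb1, conn_zero_one]
  · exact hK 0 b (by simp) hb hb1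

lemma IsKundt.nab (hK : F.IsKundt) {s : ℤ} {T : Comp d A} (hT : BoostLE s T) (c : Fin (d + 2)) :
    BoostLE (s + if c = 1 then 1 else 0) (F.nab c T) := by
  intro l hl
  have h := hT.act (m := F.conn c) (fun a b hab => hK.conn_eq_zero hab) l hl
  have h0 : T l = 0 := hT l (by split_ifs at hl <;> linarith)
  simp only [FrameConnection.nab, h0, map_zero, zero_sub]
  exact neg_eq_zero.2 h

/-- Only the derivative along `e 0` can raise the boost order. -/
lemma IsKundt.nab_eq_zero (hK : F.IsKundt) {s : ℤ} {T : Comp d A} (hT : BoostLE s T)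
    {c : Fin (d + 2)} (hc : c ≠ 0) {l : List (Fin (d + 2))} (hl : s < wt c + listWt l) :
    F.nab c T l = 0 := by
  refine hK.nab hT c l ?_
  by_cases h1 : c = 1
  · subst h1; simp only [wt_one] at hl; simp only [if_true]; linarith
  · rw [wt_of_ne hc h1] at hl; simp only [h1, if_false]; linarith

/-! ### Iterated derivatives along the null direction -/

/-- The components of `T` whose first `w` indices are `0`. -/
def leadingZeros (w : ℕ) (T : Comp d A) : Comp d A := fun l => T (List.replicate w 0 ++ l)

variable (F)

/-- The derivative along `e 0` of a tensor whose components carry, in addition to the indices of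
`T`, a number `w` of indices `0`. -/
def weightedDer (w : ℕ) (T : Comp d A) : Comp d A :=
  fun l => F.nab 0 T l - w * F.conn 0 0 0 * T l

/-- The `m`-fold weighted derivative, starting with weight `w`. -/
def iterWeightedDer : ℕ → ℕ → Comp d A → Comp d A
  | 0, _, T => T
  | m + 1, w, T => iterWeightedDer m (w + 1) (F.weightedDer w T)

variable {F}

omit [CommRing A] [Algebra ℝ A] in
@[simp] lemma leadingZeros_zero (T : Comp d A) : leadingZeros 0 T = T := rfl

lemma IsKundt.leadingZeros_nab (hK : F.IsKundt) (w : ℕ) (T : Comp d A) :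
    leadingZeros w (F.nab 0 T) = F.weightedDer w (leadingZeros w T) := by
  induction w generalizing T with
  | zero => funext l; simp [weightedDer]
  | succ w ih =>
    rw [show leadingZeros (w + 1) T = leadingZeros w (fun l' => T (0 :: l')) from rfl]
    funext l
    have h := congrFun (ih (fun l' => T (0 :: l'))) l
    simp only [leadingZeros, weightedDer, List.replicate_succ, List.cons_append, nab_cons] at h ⊢
    rw [h, Finset.sum_eq_single 0 (fun b _ hb => by rw [hK.conn_zero_zero hb, zero_mul]) (by simp)]
    push_cast; ring

lemma IsKundt.leadingZeros_grad (hK : F.IsKundt) (w : ℕ) (T : Comp d A) :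
    leadingZeros (w + 1) (F.grad T) = F.weightedDer w (leadingZeros w T) := by
  rw [← hK.leadingZeros_nab]; rfl

/-- The weighted derivatives along `e 0` are the components of the iterated covariant derivative
whose derivative indices are all `0`. -/
lemma IsKundt.leadingZeros_iterate_grad (hK : F.IsKundt) (m w : ℕ) (T : Comp d A) :
    leadingZeros (w + m) (F.grad^[m] T) = F.iterWeightedDer m w (leadingZeros w T) := by
  induction m generalizing w T with
  | zero => rfl
  | succ m ih =>
    rw [Function.iterate_succ_apply, iterWeightedDer, ← hK.leadingZeros_grad, ← ih,
      show w + (m + 1) = w + 1 + m by ring]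

lemma IsKundt.iterate_grad_replicate (hK : F.IsKundt) (m : ℕ) (T : Comp d A)
    (l : List (Fin (d + 2))) :
    F.grad^[m] T (List.replicate m 0 ++ l) = F.iterWeightedDer m 0 T l := by
  have h := congrFun (hK.leadingZeros_iterate_grad m 0 T) l
  rw [zero_add] at h
  exact h

lemma weightedDer_antisymm {Y W : Comp d A}
    (h : ∀ p q l, Y (p :: q :: l) - Y (q :: p :: l) = -W (p :: q :: l)) (w : ℕ) (p q : Fin (d + 2))
    (l : List (Fin (d + 2))) :
    F.weightedDer w Y (p :: q :: l) - F.weightedDer w Y (q :: p :: l)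
      = -F.weightedDer w W (p :: q :: l) := by
  simp only [weightedDer]
  linear_combination F.nab_antisymm h 0 p q l - w * F.conn 0 0 0 * h p q l

lemma iterWeightedDer_antisymm {Y W : Comp d A}
    (h : ∀ p q l, Y (p :: q :: l) - Y (q :: p :: l) = -W (p :: q :: l)) (m w : ℕ)
    (p q : Fin (d + 2)) (l : List (Fin (d + 2))) :
    F.iterWeightedDer m w Y (p :: q :: l) - F.iterWeightedDer m w Y (q :: p :: l)
      = -F.iterWeightedDer m w W (p :: q :: l) := by
  induction m generalizing w Y W with
  | zero => exact h p q l
  | succ m ih => exact ih (weightedDer_antisymm h w) (w + 1)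

lemma HasBianchiSymm.weightedDer {Y : Comp d A} (h : HasBianchiSymm Y) (w : ℕ) :
    HasBianchiSymm (F.weightedDer w Y) := by
  constructor
  · intro m a b p q
    have := (h.nab F 0).pair m a b p q
    simp only [FrameConnection.weightedDer, this, h.pair m a b p q]
  · intro m a b p q
    simp only [FrameConnection.weightedDer]
    linear_combination (h.nab F 0).cyclic m a b p q - w * F.conn 0 0 0 * h.cyclic m a b p q

lemma HasBianchiSymm.iterWeightedDer {Y : Comp d A} (h : HasBianchiSymm Y) (m w : ℕ) :
    HasBianchiSymm (F.iterWeightedDer m w Y) := by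
  induction m generalizing w Y with
  | zero => exact h
  | succ m ih => exact ih (h.weightedDer w) (w + 1)

variable (F) in
/-- `T` has boost order at most `s`, and each of the first `N` weighted derivatives along `e 0`
lowers this bound by one. -/
def DerBoostLE : ℕ → ℤ → ℕ → Comp d A → Prop
  | 0, s, _, T => BoostLE s T
  | N + 1, s, w, T => BoostLE s T ∧ DerBoostLE N (s - 1) (w + 1) (F.weightedDer w T)

lemma DerBoostLE.boostLE {N : ℕ} {s : ℤ} {w : ℕ} {T : Comp d A} (h : F.DerBoostLE N s w T) :
    BoostLE s T := by
  cases N with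
  | zero => exact h
  | succ N => exact h.1

lemma DerBoostLE.of_succ {N : ℕ} {s : ℤ} {w : ℕ} {T : Comp d A} (h : F.DerBoostLE (N + 1) s w T) :
    F.DerBoostLE N s w T := by
  induction N generalizing s w T with
  | zero => exact h.1
  | succ N ih => exact ⟨h.1, ih h.2⟩

lemma DerBoostLE.add {N : ℕ} {s : ℤ} {w : ℕ} {S T : Comp d A} (hS : F.DerBoostLE N s w S)
    (hT : F.DerBoostLE N s w T) : F.DerBoostLE N s w (fun l => S l + T l) := by
  have h0 : BoostLE s (fun l => S l + T l) := fun l hl => by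
    simp only [hS.boostLE l hl, hT.boostLE l hl, add_zero]
  induction N generalizing s w S T with
  | zero => exact h0
  | succ N ih =>
    have e : F.weightedDer w (fun l => S l + T l)
        = fun l => F.weightedDer w S l + F.weightedDer w T l := by
      funext l; simp only [weightedDer, nab_add]; ring
    refine ⟨h0, ?_⟩
    rw [e]
    refine ih hS.2 hT.2 fun l hl => ?_
    simp only [hS.2.boostLE l hl, hT.2.boostLE l hl, add_zero]

lemma DerBoostLE.iterWeightedDer {N : ℕ} {s : ℤ} {w : ℕ} {T : Comp d A}
    (h : F.DerBoostLE N s w T) : BoostLE (s - N) (F.iterWeightedDer N w T) := by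
  induction N generalizing s w T with
  | zero => rw [Nat.cast_zero, sub_zero]; exact h
  | succ N ih =>
    have := ih h.2
    rwa [show s - 1 - (N : ℤ) = s - (N + 1 : ℕ) by push_cast; ring] at this

lemma weightedDer_curvAct (w w' : ℕ) (Q S : Comp d A) :
    F.weightedDer (w + w') (curvAct Q S)
      = fun l => curvAct (F.weightedDer w Q) S l + curvAct Q (F.weightedDer w' S) l := by
  have h1 : ∀ l, curvAct (F.weightedDer w Q) S l
      = curvAct (F.nab 0 Q) S l - w * F.conn 0 0 0 * curvAct Q S l := by
    intro l
    match l with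
    | [] | [_] => simp [curvAct]
    | p :: q :: l =>
      have : rankFourMat (F.weightedDer w Q) p q
          = rankFourMat (F.nab 0 Q) p q - (w * F.conn 0 0 0) • rankFourMat Q p q := by
        ext a b; simp [rankFourMat, weightedDer]
      simp only [curvAct, this, sub_act, smul_act]
  have h2 : ∀ l, curvAct Q (F.weightedDer w' S) l
      = curvAct Q (F.nab 0 S) l - w' * F.conn 0 0 0 * curvAct Q S l := by
    intro l
    match l with
    | [] | [_] => simp [curvAct]
    | p :: q :: l =>
      have : F.weightedDer w' S = fun l => F.nab 0 S l - (w' * F.conn 0 0 0) * S l := rfl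
      simp only [curvAct, this, act_sub, act_mul]
  funext l
  rw [h1, h2, weightedDer, nab_curvAct]
  push_cast; ring

lemma DerBoostLE.curvAct {N : ℕ} {s t : ℤ} {w w' : ℕ} {Q S : Comp d A}
    (hQ : F.DerBoostLE N s w Q) (hS : F.DerBoostLE N t w' S) :
    F.DerBoostLE N (s + t) (w + w') (FrameConnection.curvAct Q S) := by
  induction N generalizing s t w w' Q S with
  | zero => exact BoostLE.curvAct hQ hS
  | succ N ih =>
    refine ⟨hQ.boostLE.curvAct hS.boostLE, ?_⟩
    rw [weightedDer_curvAct]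
    refine DerBoostLE.add ?_ ?_
    · have := ih hQ.2 hS.of_succ
      rwa [show s - 1 + t = s + t - 1 by ring, show w + 1 + w' = w + w' + 1 by ring] at this
    · have := ih hQ.of_succ hS.2
      rwa [show s + (t - 1) = s + t - 1 by ring] at this

/-- If `T` and its first `N` covariant derivatives have boost order at most `s`, then each index `0`
in front, whether it belongs to `T` or to a derivative, is paid for by the other indices. -/
lemma IsKundt.derBoostLE_leadingZeros (hK : F.IsKundt) {N : ℕ} {s : ℤ} {w : ℕ} {T : Comp d A}
    (h : ∀ i ≤ N, BoostLE s (F.grad^[i] T)) : F.DerBoostLE N (s - w) w (leadingZeros w T) := by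
  have h0 : BoostLE (s - w) (leadingZeros w T) := fun l hl =>
    h 0 (Nat.zero_le _) _ (by rw [listWt_append, listWt_replicate_zero]; linarith)
  induction N generalizing w T with
  | zero => exact h0
  | succ N ih =>
    refine ⟨h0, ?_⟩
    rw [← hK.leadingZeros_grad, show s - (w : ℤ) - 1 = s - (w + 1 : ℕ) by push_cast; ring]
    have h1 : ∀ i ≤ N, BoostLE s (F.grad^[i] (F.grad T)) := fun i hi => h (i + 1) (by omega)
    exact ih h1 fun l hl => h1 0 (Nat.zero_le _) _
      (by rw [listWt_append, listWt_replicate_zero]; linarith)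

lemma IsKundt.derBoostLE (hK : F.IsKundt) {N : ℕ} {s : ℤ} {T : Comp d A}
    (h : ∀ i ≤ N, BoostLE s (F.grad^[i] T)) : F.DerBoostLE N s 0 T := by
  have := hK.derBoostLE_leadingZeros (w := 0) h
  rwa [Nat.cast_zero, sub_zero] at this

end FrameConnection

namespace FrameConnection

variable {d : ℕ} {A : Type*} [CommRing A] [Algebra ℝ A] {F : FrameConnection d A}

/-! ### The induction on the order of the derivative -/

lemma nab_metricWedge (c : Fin (d + 2)) (l : List (Fin (d + 2))) : F.nab c metricWedge l = 0 := by
  have h : F.der c (metricWedge l) = 0 := by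
    have heta : ∀ a b : Fin (d + 2), F.der c (eta a b) = 0 := fun a b => by
      unfold eta; split_ifs <;> simp
    unfold metricWedge
    split
    · simp [heta]
    · simp
  rw [nab, h, act_metricWedge (F.skew c), sub_zero]

lemma nab_eq_zero_of_length {n : ℕ} {T : Comp d A} (hT : ∀ l, l.length ≠ n → T l = 0)
    (c : Fin (d + 2)) {l : List (Fin (d + 2))} (hl : l.length ≠ n) : F.nab c T l = 0 := by
  rw [nab, hT l hl, act_eq_zero_of_length fun l' hl' => hT l' (by rwa [hl'])]
  simp

lemma riem_eq_zero_of_length {l : List (Fin (d + 2))} (h : l.length ≠ 4) : F.riem l = 0 := by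
  unfold riem
  split
  · simp at h
  · rfl

lemma iterate_grad_riem_eq_zero_of_length (n : ℕ) {l : List (Fin (d + 2))}
    (h : l.length ≠ 4 + n) : F.grad^[n] F.riem l = 0 := by
  induction n generalizing l with
  | zero => exact riem_eq_zero_of_length h
  | succ n ih =>
    rw [Function.iterate_succ_apply']
    match l with
    | [] => rfl
    | c :: l =>
      rw [grad_cons]
      exact nab_eq_zero_of_length (fun l hl => ih hl) c (by simp at h; omega)

variable (F) in
/-- The curvature is the sum of a multiple of `g ∧ g` and of a tensor of type III; equivalently, the
Weyl tensor and the tracefree Ricci tensor are of type III. -/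
def IsCurvatureTypeIII (f : A) (Z : Comp d A) : Prop :=
  BoostLE (-1) Z ∧ ∀ l, F.riem l = f * metricWedge l + Z l

lemma IsCurvatureTypeIII.boostLE_riem {f : A} {Z : Comp d A} (h : F.IsCurvatureTypeIII f Z) :
    BoostLE 0 F.riem := fun l hl => by
  rw [h.2, boostLE_metricWedge l hl, h.1 l (by omega), mul_zero, add_zero]

lemma IsCurvatureTypeIII.nab_riem {f : A} {Z : Comp d A} (h : F.IsCurvatureTypeIII f Z)
    (c : Fin (d + 2)) (l : List (Fin (d + 2))) :
    F.nab c F.riem l = F.der c f * metricWedge l + F.nab c Z l := by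
  have : F.riem = fun l => f * metricWedge l + Z l := funext h.2
  rw [this, nab_add, nab_mul, nab_metricWedge, mul_zero, add_zero]

/-- The part `f g ∧ g` of the curvature acts trivially on the curvature. -/
lemma IsCurvatureTypeIII.curvAct_riem {f : A} {Z : Comp d A} (h : F.IsCurvatureTypeIII f Z) :
    curvAct F.riem F.riem = curvAct F.riem Z := by
  have e : F.riem = fun l => f * metricWedge l + Z l := funext h.2
  funext l
  match l with
  | [] | [_] => rfl
  | p :: q :: l =>
    rw [curvAct, curvAct]
    conv_lhs => rw [e]
    rw [act_add, act_mul, ← e, rankFourMat_riem, act_metricWedge (F.curv_skew p q), mul_zero,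
      zero_add]

/-- The scalar `f` is constant along `e 0`. -/
lemma IsCurvatureTypeIII.der_zero (hd : 2 ≤ d) (hK : F.IsKundt) {f : A} {Z : Comp d A}
    (h : F.IsCurvatureTypeIII f Z) : F.der 0 f = 0 := by
  obtain ⟨i, j, hi0, hi1, hj0, hj1, hij⟩ : ∃ i j : Fin (d + 2),
      i ≠ 0 ∧ i ≠ 1 ∧ j ≠ 0 ∧ j ≠ 1 ∧ i ≠ j :=
    ⟨⟨2, by omega⟩, ⟨3, by omega⟩, by simp [Fin.ext_iff]⟩
  -- the second Bianchi identity for `∇₀ R_{ijij}`, in which `Z` does not contribute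
  have hB := F.grad_riem_cyclic 0 i j i j
  simp only [grad_cons, h.nab_riem] at hB
  rw [hK.nab_eq_zero h.1 (c := i) hi0 (by simp [wt_of_ne, *]),
    hK.nab_eq_zero h.1 (c := j) hj0 (by simp [wt_of_ne, *]),
    hK.nab h.1 0 _ (by simp [wt_of_ne, *])] at hB
  simpa [metricWedge, eta, conj_of_ne, *, hij.symm, eq_comm] using hB

/-- The scalar `f` is constant along the transverse directions; this is where at least two of these
are needed. -/
lemma IsCurvatureTypeIII.der_of_ne (hd : 2 ≤ d) (hK : F.IsKundt) {f : A} {Z : Comp d A}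
    (h : F.IsCurvatureTypeIII f Z) {i : Fin (d + 2)} (hi0 : i ≠ 0) (hi1 : i ≠ 1) :
    F.der i f = 0 := by
  obtain ⟨j, hj0, hj1, hij⟩ : ∃ j : Fin (d + 2), j ≠ 0 ∧ j ≠ 1 ∧ i ≠ j := by
    by_cases hi2 : i = ⟨2, by omega⟩
    · exact ⟨⟨3, by omega⟩, by simp [Fin.ext_iff, hi2]⟩
    · exact ⟨⟨2, by omega⟩, by simp [Fin.ext_iff], by simp [Fin.ext_iff], hi2⟩
  -- the component `∇₀ R_{1jij}` is computed in two ways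
  have hB1 := F.grad_riem_cyclic 0 1 j i j
  have hB2 := F.grad_riem_cyclic 0 i j 1 j
  rw [F.hasBianchiSymm_grad_riem.pair 0 1 j i j] at hB1
  simp only [grad_cons] at hB1 hB2
  rw [h.nab_riem i, h.nab_riem j,
    hK.nab_eq_zero h.1 (c := i) hi0 (by simp [wt_of_ne, *]),
    hK.nab_eq_zero h.1 (c := j) hj0 (by simp [wt_of_ne, *])] at hB1
  rw [h.nab_riem 1, h.nab_riem j,
    hK.nab_eq_zero h.1 (c := 1) (by simp) (by simp [wt_of_ne, *]),
    hK.nab_eq_zero h.1 (c := j) hj0 (by simp [wt_of_ne, *])] at hB2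
  simp only [metricWedge, eta, conj_of_ne hi0 hi1, conj_of_ne hj0 hj1, conj_one,
    hij, hij.symm, hi0, hj0, hi0.symm, hi1.symm, hj0.symm, hj1.symm, if_true, if_false]
    at hB1 hB2
  linear_combination hB2 - hB1

/-- Components of the first derivative of the curvature that differentiate along `e c` with
`c ≠ 0`. -/
lemma IsCurvatureTypeIII.nab_riem_eq_zero (hd : 2 ≤ d) (hK : F.IsKundt) {f : A} {Z : Comp d A}
    (h : F.IsCurvatureTypeIII f Z) {c : Fin (d + 2)} (hc : c ≠ 0) {l : List (Fin (d + 2))}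
    (hl : 0 ≤ wt c + listWt l) : F.nab c F.riem l = 0 := by
  rw [h.nab_riem, hK.nab_eq_zero h.1 hc (by omega), add_zero]
  by_cases hc1 : c = 1
  · rw [boostLE_metricWedge l (by simp [hc1] at hl; omega), mul_zero]
  · rw [h.der_of_ne hd hK hc hc1, zero_mul]

lemma IsCurvatureTypeIII.weightedDer_riem (hd : 2 ≤ d) (hK : F.IsKundt) {f : A} {Z : Comp d A}
    (h : F.IsCurvatureTypeIII f Z) : F.weightedDer 0 F.riem = F.weightedDer 0 Z := by
  funext l
  simp [weightedDer, h.nab_riem, h.der_zero hd hK]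

/-- The `m`-fold derivative along `e 0` of the commutator terms has boost order below `-m`. Each of
the factors loses one unit of boost order with each derivative; the part `f g ∧ g` of the curvature,
which has boost order zero, has been removed from the second factor if `r = 0`. -/
lemma IsCurvatureTypeIII.boostLE_curvAct (hd : 2 ≤ d) (hK : F.IsKundt) {f : A} {Z : Comp d A}
    (h : F.IsCurvatureTypeIII f Z) {m r : ℕ}
    (hI : ∀ j, 1 ≤ j → j ≤ m + r → BoostLE (-1) (F.grad^[j] F.riem)) :
    BoostLE (-1 - m) (F.iterWeightedDer m 0 (curvAct F.riem (F.grad^[r] F.riem))) := by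
  have h0 : F.DerBoostLE m 0 0 F.riem := hK.derBoostLE fun i hi => by
    rcases Nat.eq_zero_or_pos i with rfl | hi0
    · exact h.boostLE_riem
    · exact (hI i hi0 (by omega)).mono (by norm_num)
  suffices h1 : ∃ X, F.DerBoostLE m (-1) 0 X ∧
      curvAct F.riem (F.grad^[r] F.riem) = curvAct F.riem X by
    obtain ⟨X, hX, e⟩ := h1
    rw [e]
    have := (h0.curvAct hX).iterWeightedDer
    rwa [zero_add] at this
  rcases Nat.eq_zero_or_pos r with rfl | hr
  · refine ⟨Z, ?_, h.curvAct_riem⟩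
    cases m with
    | zero => exact h.1
    | succ m =>
      refine ⟨h.1, ?_⟩
      rw [← h.weightedDer_riem hd hK]
      have := hK.leadingZeros_grad 0 F.riem
      rw [leadingZeros_zero] at this
      rw [← this]
      exact hK.derBoostLE_leadingZeros (w := 1) (s := -1) fun i hi =>
        hI (i + 1) (by omega) (by omega)
  · refine ⟨_, hK.derBoostLE fun i hi => ?_, rfl⟩
    rw [← Function.iterate_add_apply]
    exact hI _ (by omega) (by omega)

lemma exists_eq_replicate_zero_append (n : ℕ) (l : List (Fin (d + 2))) (hl : n ≤ l.length) :
    (∃ m < n, ∃ c l', c ≠ 0 ∧ l = List.replicate m 0 ++ c :: l')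
      ∨ ∃ l', l = List.replicate n 0 ++ l' := by
  induction n generalizing l with
  | zero => exact Or.inr ⟨l, rfl⟩
  | succ n ih =>
    match l with
    | [] => simp at hl
    | a :: l =>
      by_cases ha : a = 0
      · subst ha
        rcases ih l (by simpa using hl) with ⟨m, hm, c, l', hc, rfl⟩ | ⟨l', rfl⟩
        · exact Or.inl ⟨m + 1, by omega, c, l', hc, rfl⟩
        · exact Or.inr ⟨l', rfl⟩
      · exact Or.inl ⟨0, by omega, a, l, ha, rfl⟩

/-- The induction step: a component of nonnegative boost weight of the derivative of order `I + 1`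
vanishes if one of the derivative indices is not `0`, as such an index can be moved to the front by
the Ricci identity; if all of them are `0`, the second Bianchi identity exchanges the last one for
another index. -/
lemma IsCurvatureTypeIII.boostLE_succ (hd : 2 ≤ d) (hK : F.IsKundt) {f : A} {Z : Comp d A}
    (h : F.IsCurvatureTypeIII f Z) {I : ℕ}
    (hI : ∀ j, 1 ≤ j → j ≤ I → BoostLE (-1) (F.grad^[j] F.riem)) :
    BoostLE (-1) (F.grad^[I + 1] F.riem) := by
  have first : ∀ c l, c ≠ 0 → 0 ≤ wt c + listWt l → F.nab c (F.grad^[I] F.riem) l = 0 := by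
    intro c l hc hl
    rcases Nat.eq_zero_or_pos I with rfl | hI0
    · exact h.nab_riem_eq_zero hd hK hc hl
    · exact hK.nab_eq_zero (hI I hI0 le_rfl) hc (by omega)
  have zero : ∀ l, 0 ≤ listWt l → F.nab 0 (F.grad^[I] F.riem) l = 0 := by
    intro l hl
    rcases Nat.eq_zero_or_pos I with rfl | hI0
    · rw [Function.iterate_zero_apply, h.nab_riem, h.der_zero hd hK, zero_mul, zero_add,
        hK.nab h.1 0 l (by simpa using by omega)]
    · exact hK.nab (hI I hI0 le_rfl) 0 l (by simpa using by omega)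
  have moved : ∀ m, m ≤ I → ∀ c l, c ≠ 0 → 0 ≤ (m : ℤ) + wt c + listWt l →
      F.grad^[I + 1] F.riem (List.replicate m 0 ++ c :: l) = 0 := by
    intro m
    induction m with
    | zero =>
      intro _ c l hc hl
      rw [Function.iterate_succ_apply']
      exact first c l hc (by simpa using hl)
    | succ m ih =>
      intro hm c l hc hl
      obtain ⟨r, rfl⟩ : ∃ r, I = m + 1 + r := ⟨I - (m + 1), by omega⟩
      have e : ∀ l', F.grad^[m + 1 + r + 1] F.riem (List.replicate m 0 ++ l')
          = F.iterWeightedDer m 0 (F.grad (F.grad (F.grad^[r] F.riem))) l' := fun l' => by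
        rw [← hK.iterate_grad_replicate, ← Function.iterate_succ_apply' F.grad r,
          ← Function.iterate_succ_apply' F.grad (r + 1), ← Function.iterate_add_apply,
          show m + 1 + r + 1 = m + (r + 1 + 1) by ring]
      have h1 := ih (by omega) c (0 :: l) hc (by simp; push_cast at hl; linarith)
      have h2 := iterWeightedDer_antisymm (F := F)
        (fun p q l => F.grad_grad_sub p q (F.grad^[r] F.riem) l) m 0 0 c l
      have h3 := h.boostLE_curvAct hd hK (m := m) (r := r) (fun j h1 h2 => hI j h1 (by omega))
        (0 :: c :: l) (by simp; push_cast at hl; linarith)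
      rw [List.replicate_succ', List.append_assoc, List.singleton_append, e]
      rw [e] at h1
      linear_combination h1 + h2 - h3
  intro l hl
  match l with
  | [] => rw [Function.iterate_succ_apply']; rfl
  | c :: l =>
    rw [listWt_cons] at hl
    by_cases hc : c = 0
    swap
    · rw [Function.iterate_succ_apply']
      exact first c l hc (by omega)
    subst hc
    rw [wt_zero] at hl
    by_cases hl0 : 0 ≤ listWt l
    · rw [Function.iterate_succ_apply']
      exact zero l hl0
    by_cases hlen : (0 :: l).length = 4 + (I + 1)
    swap
    · exact iterate_grad_riem_eq_zero_of_length _ hlen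
    rcases exists_eq_replicate_zero_append (I + 1) (0 :: l) (by omega) with
      ⟨m, hm, c, l', hc, e⟩ | ⟨l', e⟩
    · have hw := congrArg listWt e
      simp only [listWt_cons, listWt_append, listWt_replicate_zero, wt_zero] at hw
      rw [e]
      exact moved m (by omega) c l' hc (by omega)
    · have hw := congrArg listWt e
      rw [e, List.length_append, List.length_replicate] at hlen
      obtain ⟨a, b, p, q, rfl⟩ := List.length_eq_four.1 (show l'.length = 4 by omega)
      simp only [listWt_cons, listWt_append, listWt_replicate_zero, listWt_nil, wt_zero] at hw
      have hY : HasBianchiSymm (F.iterWeightedDer I 0 (F.grad F.riem)) :=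
        F.hasBianchiSymm_grad_riem.iterWeightedDer I 0
      have hmoved : ∀ c l, c ≠ 0 → 0 ≤ (I : ℤ) + wt c + listWt l →
          F.iterWeightedDer I 0 (F.grad F.riem) (c :: l) = 0 := fun c l hc hl => by
        rw [← hK.iterate_grad_replicate, ← Function.iterate_succ_apply]
        exact moved I le_rfl c l hc hl
      rw [e, List.replicate_succ', List.append_assoc, List.singleton_append,
        Function.iterate_succ_apply, hK.iterate_grad_replicate]
      have hpq : ∀ a b p q, p ≠ 0 → q ≠ 0 → 0 ≤ (I : ℤ) + 1 + wt a + wt b + wt p + wt q →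
          F.iterWeightedDer I 0 (F.grad F.riem) [0, a, b, p, q] = 0 := by
        intro a b p q hp hq hw
        have hB := hY.cyclic 0 a b p q
        rwa [hmoved p [a, b, q, 0] hp (by simp; linarith),
          hmoved q [a, b, 0, p] hq (by simp; linarith),
          add_zero, add_zero] at hB
      -- if both index pairs contained a `0`, their boost weight would not be negative
      by_cases hp : p ≠ 0 ∧ q ≠ 0
      · exact hpq a b p q hp.1 hp.2 (by push_cast at hw; omega)
      by_cases ha : a ≠ 0 ∧ b ≠ 0
      · rw [hY.pair]
        exact hpq p q a b ha.1 ha.2 (by push_cast at hw; omega)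
      exfalso
      have key : ∀ x y : Fin (d + 2), ¬(x ≠ 0 ∧ y ≠ 0) → 0 ≤ wt x + wt y := by
        intro x y hxy
        have := neg_one_le_wt x
        have := neg_one_le_wt y
        by_cases hx : x = 0
        · rw [hx, wt_zero]; omega
        · have hy : y = 0 := by tauto
          rw [hy, wt_zero]; omega
      have := key p q hp
      have := key a b ha
      push_cast at hw
      omega

/-- All covariant derivatives of the curvature are of type III. -/
theorem IsCurvatureTypeIII.boostLE_iterate_grad (hd : 2 ≤ d) (hK : F.IsKundt) {f : A}
    {Z : Comp d A} (h : F.IsCurvatureTypeIII f Z) {I : ℕ} (hI : 1 ≤ I) :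
    BoostLE (-1) (F.grad^[I] F.riem) := by
  induction I using Nat.strong_induction_on with
  | _ I ih =>
    obtain ⟨I, rfl⟩ : ∃ J, I = J + 1 := ⟨I - 1, by omega⟩
    exact h.boostLE_succ hd hK fun j hj hjI => ih j (by omega) hj

end FrameConnection

/-! ### Calculus of smooth functions and vector fields on an open set -/

section Calculus

variable {d : ℕ} {M : Type*} [TopologicalSpace M] [ChartedSpace (Model d) M]

/-- The scalar field `f` is smooth on `U`. -/
abbrev FunSmoothOn (d : ℕ) {M : Type*} [TopologicalSpace M] [ChartedSpace (Model d) M]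
    (f : M → ℝ) (U : Set M) : Prop :=
  ContMDiffOn 𝓘(ℝ, Model d) 𝓘(ℝ, ℝ) ∞ f U

variable {U V : Set M} {x : M} {f h : M → ℝ} {X Y Z : VField d M}

lemma FunSmoothOn.mdifferentiableAt (hf : FunSmoothOn d f U) (hU : IsOpen U) (hx : x ∈ U) :
    MDifferentiableAt 𝓘(ℝ, Model d) 𝓘(ℝ, ℝ) f x :=
  (hf.contMDiffAt (hU.mem_nhds hx)).mdifferentiableAt (by simp)

lemma dirDeriv_eq (X : VField d M) (f : M → ℝ) (x : M) :
    dirDeriv X f x = mvfderiv 𝓘(ℝ, Model d) f x (X x) := rfl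

lemma dirDeriv_congr (hfh : f =ᶠ[𝓝 x] h) : dirDeriv X f x = dirDeriv X h x :=
  DFunLike.congr_fun
    (hfh.mfderiv_eq (I := 𝓘(ℝ, Model d)) (I' := 𝓘(ℝ, ℝ))) (X x)

lemma dirDeriv_add (hf : FunSmoothOn d f U) (hh : FunSmoothOn d h U) (hU : IsOpen U) (hx : x ∈ U) :
    dirDeriv X (fun y => f y + h y) x = dirDeriv X f x + dirDeriv X h x := by
  simp only [dirDeriv_eq]
  rw [mvfderiv_fun_add (hf.mdifferentiableAt hU hx) (hh.mdifferentiableAt hU hx)]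
  rfl

lemma dirDeriv_mul (hf : FunSmoothOn d f U) (hh : FunSmoothOn d h U) (hU : IsOpen U) (hx : x ∈ U) :
    dirDeriv X (fun y => f y * h y) x = f x * dirDeriv X h x + h x * dirDeriv X f x := by
  simp only [dirDeriv_eq]
  rw [mvfderiv_fun_mul (hf.mdifferentiableAt hU hx) (hh.mdifferentiableAt hU hx)]
  rfl

lemma dirDeriv_const (c : ℝ) : dirDeriv X (fun _ => c) x = 0 := by
  rw [dirDeriv_eq, mvfderiv_const]; rfl

variable [IsManifold 𝓘(ℝ, Model d) ∞ M]

lemma SmoothOn.mdifferentiableAt (hX : SmoothOn X U) (hU : IsOpen U) (hx : x ∈ U) :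
    MDifferentiableAt 𝓘(ℝ, Model d) (𝓘(ℝ, Model d)).tangent
      (fun x => (⟨x, X x⟩ : TangentBundle 𝓘(ℝ, Model d) M)) x :=
  (ContMDiffOn.contMDiffAt hX (hU.mem_nhds hx)).mdifferentiableAt (by simp)

lemma FunSmoothOn.dirDeriv (hf : FunSmoothOn d f U) (hX : SmoothOn X U) (hU : IsOpen U) :
    FunSmoothOn d (dirDeriv X f) U := by
  have h1 := hf.contMDiffOn_tangentMapWithin (m := ∞) (by simp) hU.uniqueMDiffOn
  have h2 : ContMDiffOn 𝓘(ℝ, Model d) (𝓘(ℝ, ℝ)).tangent ∞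
      (fun x => tangentMapWithin 𝓘(ℝ, Model d) 𝓘(ℝ, ℝ) f U ⟨x, X x⟩) U :=
    h1.comp hX (fun x hx => hx)
  have h3 := (contMDiff_snd_tangentBundle_modelSpace ℝ 𝓘(ℝ, ℝ) (n := ∞)).comp_contMDiffOn h2
  exact h3.congr fun x hx => (DFunLike.congr_fun (mfderivWithin_of_isOpen hU hx) (X x)).symm

lemma SmoothOn.congr (hX : SmoothOn X U) (h : ∀ x ∈ U, Y x = X x) : SmoothOn Y U :=
  ContMDiffOn.congr hX fun x hx => by rw [h x hx]

lemma SmoothOn.mono (hX : SmoothOn X U) (h : V ⊆ U) : SmoothOn X V := ContMDiffOn.mono hX h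

lemma SmoothOn.smul (hf : FunSmoothOn d f U) (hX : SmoothOn X U) : SmoothOn (f • X) U :=
  ContMDiffOn.smul_section hf hX

lemma SmoothOn.sum {κ : Type*} (s : Finset κ) (X : κ → VField d M) (hX : ∀ k, SmoothOn (X k) U) :
    SmoothOn (∑ k ∈ s, X k) U := by
  have := ContMDiffOn.sum_section (s := s) (t := X) (fun k _ => hX k)
  exact SmoothOn.congr this fun x _ => by simp

open VectorField

lemma SmoothOn.mlieBracket (hX : SmoothOn X U) (hY : SmoothOn Y U) (hU : IsOpen U) :
    SmoothOn (mlieBracket 𝓘(ℝ, Model d) X Y) U := fun x hx => by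
  have : IsManifold 𝓘(ℝ, Model d) ((⊤ : ℕ∞) + 1) M := by simpa
  have : IsManifold 𝓘(ℝ, Model d) (minSmoothness ℝ 2) M := by
    rw [minSmoothness_of_isRCLikeNormedField]; infer_instance
  refine (ContMDiffAt.mlieBracket_vectorField (m := ⊤) (n := ⊤)
    (ContMDiffOn.contMDiffAt hX (hU.mem_nhds hx))
    (ContMDiffOn.contMDiffAt hY (hU.mem_nhds hx)) (by simp)).contMDiffWithinAt

omit [IsManifold 𝓘(ℝ, Model d) ∞ M] in
lemma mlieBracket_congr (hU : IsOpen U) (hx : x ∈ U) {X' Y' : VField d M}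
    (hX : ∀ y ∈ U, X y = X' y) (hY : ∀ y ∈ U, Y y = Y' y) :
    mlieBracket 𝓘(ℝ, Model d) X Y x = mlieBracket 𝓘(ℝ, Model d) X' Y' x :=
  Filter.EventuallyEq.mlieBracket_vectorField_eq
    (Filter.eventually_of_mem (hU.mem_nhds hx) hX) (Filter.eventually_of_mem (hU.mem_nhds hx) hY)

lemma mlieBracket_smul (hf : FunSmoothOn d f U) (hY : SmoothOn Y U) (hU : IsOpen U) (hx : x ∈ U) :
    mlieBracket 𝓘(ℝ, Model d) X (f • Y) x
      = dirDeriv X f x • Y x + f x • mlieBracket 𝓘(ℝ, Model d) X Y x :=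
  mlieBracket_smul_right (hf.mdifferentiableAt hU hx) (hY.mdifferentiableAt hU hx)

lemma mlieBracket_add (hY : SmoothOn Y U) (hZ : SmoothOn Z U) (hU : IsOpen U) (hx : x ∈ U) :
    mlieBracket 𝓘(ℝ, Model d) X (Y + Z) x
      = mlieBracket 𝓘(ℝ, Model d) X Y x + mlieBracket 𝓘(ℝ, Model d) X Z x :=
  mlieBracket_add_right (hY.mdifferentiableAt hU hx) (hZ.mdifferentiableAt hU hx)

lemma mlieBracket_sum {κ : Type*} (s : Finset κ) (Y : κ → VField d M) (hY : ∀ k, SmoothOn (Y k) U)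
    (hU : IsOpen U) (hx : x ∈ U) :
    mlieBracket 𝓘(ℝ, Model d) X (∑ k ∈ s, Y k) x
      = ∑ k ∈ s, mlieBracket 𝓘(ℝ, Model d) X (Y k) x := by
  classical
  induction s using Finset.induction_on with
  | empty => simp
  | insert k s hk ih =>
    rw [Finset.sum_insert hk, Finset.sum_insert hk,
      mlieBracket_add (hY k) (SmoothOn.sum s Y hY) hU hx, ih]

lemma mlieBracket_jacobi (hX : SmoothOn X U) (hY : SmoothOn Y U) (hZ : SmoothOn Z U)
    (hU : IsOpen U) (hx : x ∈ U) :
    mlieBracket 𝓘(ℝ, Model d) X (mlieBracket 𝓘(ℝ, Model d) Y Z) x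
      = mlieBracket 𝓘(ℝ, Model d) (mlieBracket 𝓘(ℝ, Model d) X Y) Z x
        + mlieBracket 𝓘(ℝ, Model d) Y (mlieBracket 𝓘(ℝ, Model d) X Z) x := by
  have : IsManifold 𝓘(ℝ, Model d) (minSmoothness ℝ 3) M := by
    rw [minSmoothness_of_isRCLikeNormedField]; infer_instance
  have h : ∀ {X : VField d M}, SmoothOn X U → ContMDiffAt 𝓘(ℝ, Model d) (𝓘(ℝ, Model d)).tangent
      (minSmoothness ℝ 2) (fun x => (⟨x, X x⟩ : TangentBundle 𝓘(ℝ, Model d) M)) x := fun hX => by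
    rw [minSmoothness_of_isRCLikeNormedField]
    exact (ContMDiffOn.contMDiffAt hX (hU.mem_nhds hx)).of_le ENat.LEInfty.out
  exact leibniz_identity_mlieBracket_apply (h hX) (h hY) (h hZ)

/-- The bracket of vector fields is the commutator of the directional derivatives. This follows from
the Leibniz rule and the Jacobi identity for `X`, `Y` and `f • Z`, where `Z` does not vanish. -/
lemma dirDeriv_mlieBracket (hX : SmoothOn X U) (hY : SmoothOn Y U) (hf : FunSmoothOn d f U)
    (hZ : SmoothOn Z U) (hU : IsOpen U) (hx : x ∈ U) (hZx : Z x ≠ 0) :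
    dirDeriv (mlieBracket 𝓘(ℝ, Model d) X Y) f x
      = dirDeriv X (dirDeriv Y f) x - dirDeriv Y (dirDeriv X f) x := by
  have key : ∀ {X Y : VField d M}, SmoothOn X U → SmoothOn Y U →
      mlieBracket 𝓘(ℝ, Model d) X (mlieBracket 𝓘(ℝ, Model d) Y (f • Z)) x
        = dirDeriv X (dirDeriv Y f) x • Z x + dirDeriv Y f x • mlieBracket 𝓘(ℝ, Model d) X Z x
          + (dirDeriv X f x • mlieBracket 𝓘(ℝ, Model d) Y Z x
            + f x • mlieBracket 𝓘(ℝ, Model d) X (mlieBracket 𝓘(ℝ, Model d) Y Z) x) := by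
    intro X Y hX hY
    rw [mlieBracket_congr hU hx (Y' := dirDeriv Y f • Z + f • mlieBracket 𝓘(ℝ, Model d) Y Z)
        (fun _ _ => rfl) (fun y hy => mlieBracket_smul hf hZ hU hy),
      mlieBracket_add (SmoothOn.smul (hf.dirDeriv hY hU) hZ)
        (SmoothOn.smul hf (hY.mlieBracket hZ hU)) hU hx,
      mlieBracket_smul (hf.dirDeriv hY hU) hZ hU hx,
      mlieBracket_smul hf (hY.mlieBracket hZ hU) hU hx]
  have h1 := mlieBracket_jacobi hX hY (SmoothOn.smul hf hZ) hU hx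
  have h2 := mlieBracket_jacobi hX hY hZ hU hx
  rw [key hX hY, key hY hX, mlieBracket_smul hf hZ hU hx, h2] at h1
  have h3 : (dirDeriv (mlieBracket 𝓘(ℝ, Model d) X Y) f x
      - (dirDeriv X (dirDeriv Y f) x - dirDeriv Y (dirDeriv X f) x)) • Z x = 0 := by
    rw [sub_smul, sub_smul]
    linear_combination (norm := module) (-1 : ℝ) • h1
  rcases smul_eq_zero.1 h3 with h | h
  · linarith
  · exact absurd h hZx

end Calculus

/-! ### The ring of smooth functions on an open set -/

section Ring

variable (d : ℕ) {M : Type*} [TopologicalSpace M] [ChartedSpace (Model d) M] (U : Set M)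

/-- The ring of smooth functions on `U`: restrictions to `U` of functions on `M` that are
smooth on `U`. -/
def smoothRing : Subalgebra ℝ (U → ℝ) where
  carrier := {φ | ∃ f : M → ℝ, FunSmoothOn d f U ∧ ∀ x : U, φ x = f x}
  mul_mem' := by
    rintro _ _ ⟨f, hf, hφ⟩ ⟨h, hh, hψ⟩
    exact ⟨fun x => f x * h x, hf.mul hh, fun x => by simp [hφ, hψ]⟩
  add_mem' := by
    rintro _ _ ⟨f, hf, hφ⟩ ⟨h, hh, hψ⟩
    exact ⟨fun x => f x + h x, hf.add hh, fun x => by simp [hφ, hψ]⟩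
  algebraMap_mem' r := ⟨fun _ => r, contMDiffOn_const, fun x => rfl⟩

variable {d U}

/-- A representative, on the whole of `M`, of a smooth function on `U`. -/
def extend (φ : smoothRing d U) : M → ℝ := φ.2.choose

lemma extend_smooth (φ : smoothRing d U) : FunSmoothOn d (extend φ) U := φ.2.choose_spec.1

lemma extend_apply (φ : smoothRing d U) (x : U) : extend φ x = φ.1 x :=
  (φ.2.choose_spec.2 x).symm

/-- The restriction to `U` of a function that is smooth on `U`. -/
def restr (f : M → ℝ) (hf : FunSmoothOn d f U) : smoothRing d U :=
  ⟨fun x => f x, f, hf, fun _ => rfl⟩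

lemma extend_restr {f : M → ℝ} (hf : FunSmoothOn d f U) {x : M} (hx : x ∈ U) :
    extend (restr f hf) x = f x := extend_apply _ ⟨x, hx⟩

lemma restr_extend (φ : smoothRing d U) : restr (extend φ) (extend_smooth φ) = φ :=
  Subtype.ext (funext fun x => extend_apply φ x)

lemma extend_add (φ ψ : smoothRing d U) {x : M} (hx : x ∈ U) :
    extend (φ + ψ) x = extend φ x + extend ψ x := by
  have h := fun φ : smoothRing d U => extend_apply φ ⟨x, hx⟩
  dsimp only at h
  rw [h, h, h]; rfl

lemma extend_mul (φ ψ : smoothRing d U) {x : M} (hx : x ∈ U) :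
    extend (φ * ψ) x = extend φ x * extend ψ x := by
  have h := fun φ : smoothRing d U => extend_apply φ ⟨x, hx⟩
  dsimp only at h
  rw [h, h, h]; rfl

lemma extend_smul (r : ℝ) (φ : smoothRing d U) {x : M} (hx : x ∈ U) :
    extend (r • φ) x = r * extend φ x := by
  have h := fun φ : smoothRing d U => extend_apply φ ⟨x, hx⟩
  dsimp only at h
  rw [h, h]; rfl

variable [IsManifold 𝓘(ℝ, Model d) ∞ M]

/-- The derivation of the ring of smooth functions on `U` given by a smooth vector field. -/
def fieldDer (hU : IsOpen U) (X : VField d M) (hX : SmoothOn X U) :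
    Derivation ℝ (smoothRing d U) (smoothRing d U) :=
  Derivation.mk'
    { toFun := fun φ => restr (dirDeriv X (extend φ)) ((extend_smooth φ).dirDeriv hX hU)
      map_add' := fun φ ψ => by
        refine Subtype.ext (funext fun x => ?_)
        change dirDeriv X (extend (φ + ψ)) x = dirDeriv X (extend φ) x + dirDeriv X (extend ψ) x
        rw [← dirDeriv_add (extend_smooth φ) (extend_smooth ψ) hU x.2]
        exact dirDeriv_congr (Filter.eventually_of_mem (hU.mem_nhds x.2) fun y hy =>
          extend_add φ ψ hy)
      map_smul' := fun r φ => by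
        refine Subtype.ext (funext fun x => ?_)
        change dirDeriv X (extend (r • φ)) x = r * dirDeriv X (extend φ) x
        have h : dirDeriv X (extend (r • φ)) x = dirDeriv X (fun y => r * extend φ y) x :=
          dirDeriv_congr (Filter.eventually_of_mem (hU.mem_nhds x.2) fun y hy =>
            extend_smul r φ hy)
        rw [h, dirDeriv_mul contMDiffOn_const (extend_smooth φ) hU x.2, dirDeriv_const]
        ring }
    fun φ ψ => by
      refine Subtype.ext (funext fun x => ?_)
      change dirDeriv X (extend (φ * ψ)) x
        = φ.1 x * dirDeriv X (extend ψ) x + ψ.1 x * dirDeriv X (extend φ) x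
      rw [← extend_apply, ← extend_apply, ← dirDeriv_mul (extend_smooth φ) (extend_smooth ψ) hU x.2]
      exact dirDeriv_congr (Filter.eventually_of_mem (hU.mem_nhds x.2) fun y hy =>
        extend_mul φ ψ hy)

lemma fieldDer_restr (hU : IsOpen U) {X : VField d M} (hX : SmoothOn X U) {f : M → ℝ}
    (hf : FunSmoothOn d f U) :
    fieldDer hU X hX (restr f hf) = restr (dirDeriv X f) (hf.dirDeriv hX hU) := by
  refine Subtype.ext (funext fun x => ?_)
  exact dirDeriv_congr (Filter.eventually_of_mem (hU.mem_nhds x.2) fun y hy => extend_restr hf hy)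

end Ring

/-! ### Components in an adapted frame -/

namespace LorentzMetric

variable {d : ℕ} {M : Type*} [TopologicalSpace M] [ChartedSpace (Model d) M]
  [IsManifold 𝓘(ℝ, Model d) ∞ M] (g : LorentzMetric d M)

lemma inner_smooth {X Y : VField d M} {U : Set M} (hX : SmoothOn X U) (hY : SmoothOn Y U) :
    FunSmoothOn d (g.inner X Y) U := fun x hx => by
  have h := ContMDiffWithinAt.clm_bundle_apply₂ (F₁ := Model d) (F₂ := Model d)
    (b := fun x : M => x) (v := X) (w := Y) (s := U) (x := x) (F₃ := ℝ) (E₃ := Bundle.Trivial M ℝ)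
    ((g.smooth x).contMDiffWithinAt) (hX x hx) (hY x hx)
  exact (Bundle.contMDiffWithinAt_totalSpace.1 h).2

lemma inner_comm (X Y : VField d M) (x : M) : g.inner X Y x = g.inner Y X x := g.symm _ _ _

/-- The component of `X` along the frame vector `e b`. -/
def coef (e : Fin (d + 2) → VField d M) (X : VField d M) (b : Fin (d + 2)) : M → ℝ :=
  g.inner X (e (conj b))

variable {g} {ℓ : VField d M} {U : Set M} {e : Fin (d + 2) → VField d M}

namespace IsAdaptedFrame

lemma mono (he : g.IsAdaptedFrame ℓ U e) {V : Set M} (hV : IsOpen V) :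
    g.IsAdaptedFrame ℓ (U ∩ V) e where
  isOpen := he.isOpen.inter hV
  smooth a := (he.smooth a).mono Set.inter_subset_left
  inner_eq x hx := he.inner_eq x hx.1
  aligned x hx := he.aligned x hx.1

variable (he : g.IsAdaptedFrame ℓ U e)

include he

lemma val_eq {x : M} (hx : x ∈ U) (a b : Fin (d + 2)) :
    g.val x (e a x) (e b x) = if b = conj a then 1 else 0 :=
  (he.inner_eq x hx a b).trans (nullEta_eq a b)

lemma val_sum {x : M} (hx : x ∈ U) (c : Fin (d + 2) → ℝ) (b : Fin (d + 2)) :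
    g.val x (∑ a, c a • e a x) (e b x) = c (conj b) := by
  simp [he.val_eq hx, eq_conj_comm (a := b)]

lemma expand {x : M} (hx : x ∈ U) (v : TangentSpace 𝓘(ℝ, Model d) x) :
    v = ∑ b, g.val x v (e (conj b) x) • e b x := by
  have hli : LinearIndependent ℝ (fun a => e a x) := by
    rw [Fintype.linearIndependent_iff]
    intro c hc a
    have := he.val_sum hx c (conj a)
    rw [hc, conj_conj] at this
    simpa using this.symm
  have hcard : Fintype.card (Fin (d + 2)) = Module.finrank ℝ (TangentSpace 𝓘(ℝ, Model d) x) := by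
    change _ = Module.finrank ℝ (Model d)
    simp
  have hv : v ∈ Submodule.span ℝ (Set.range fun a => e a x) := by
    have : FiniteDimensional ℝ (TangentSpace 𝓘(ℝ, Model d) x) :=
      inferInstanceAs (FiniteDimensional ℝ (Model d))
    rw [hli.span_eq_top_of_card_eq_finrank' hcard]; trivial
  obtain ⟨c, rfl⟩ := (Submodule.mem_span_range_iff_exists_fun ℝ).1 hv
  refine Finset.sum_congr rfl fun b _ => ?_
  rw [he.val_sum hx, conj_conj]

lemma vec_ext {x : M} (hx : x ∈ U) {v w : TangentSpace 𝓘(ℝ, Model d) x}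
    (h : ∀ a, g.val x v (e a x) = g.val x w (e a x)) : v = w := by
  rw [he.expand hx v, he.expand hx w]
  exact Finset.sum_congr rfl fun b _ => by rw [h]

lemma field_expand (X : VField d M) {x : M} (hx : x ∈ U) :
    X x = (∑ b, g.coef e X b • e b) x := by
  rw [Finset.sum_apply]
  exact he.expand hx (X x)

lemma coef_smooth {X : VField d M} (hX : SmoothOn X U) (b : Fin (d + 2)) :
    FunSmoothOn d (g.coef e X b) U := g.inner_smooth hX (he.smooth _)

lemma coef_frame {x : M} (hx : x ∈ U) (a b : Fin (d + 2)) :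
    g.coef e (e a) b x = if a = b then 1 else 0 := by
  simp only [coef, inner, he.val_eq hx, conj.injective.eq_iff, eq_comm]

lemma inner_expand (X Y : VField d M) {x : M} (hx : x ∈ U) :
    g.inner X Y x = ∑ b, g.coef e X b x * g.coef e Y (conj b) x := by
  have h : g.inner X Y x = g.val x (∑ b, g.coef e X b x • e b x) (Y x) := by
    conv_lhs => rw [inner, he.expand hx (X x)]
    rfl
  rw [h]
  simp only [map_sum, map_smul, sum_apply, smul_apply,
    smul_eq_mul]
  refine Finset.sum_congr rfl fun b _ => ?_
  rw [coef, coef, conj_conj, g.inner_comm Y]; rfl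

lemma dirDeriv_expand (X : VField d M) (f : M → ℝ) {x : M} (hx : x ∈ U) :
    dirDeriv X f x = ∑ b, g.coef e X b x * dirDeriv (e b) f x := by
  have h : dirDeriv X f x = mvfderiv 𝓘(ℝ, Model d) f x (∑ b, g.coef e X b x • e b x) := by
    rw [dirDeriv_eq]
    conv_lhs => rw [he.expand hx (X x)]
    rfl
  rw [h]
  simp only [map_sum, map_smul, smul_eq_mul, dirDeriv_eq]

open VectorField

/-- The structure functions of the frame are the components `g.coef e [e a, e b] c`. -/
lemma coef_mlieBracket {X Y : VField d M} (hX : SmoothOn X U) (hY : SmoothOn Y U) {x : M}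
    (hx : x ∈ U) (c : Fin (d + 2)) :
    g.coef e (mlieBracket 𝓘(ℝ, Model d) X Y) c x
      = dirDeriv X (g.coef e Y c) x - dirDeriv Y (g.coef e X c) x
        + ∑ a, ∑ b, g.coef e X a x * g.coef e Y b x
          * g.coef e (mlieBracket 𝓘(ℝ, Model d) (e a) (e b)) c x := by
  have hU := he.isOpen
  have key : ∀ {X Y : VField d M}, SmoothOn Y U →
      mlieBracket 𝓘(ℝ, Model d) X Y x
        = ∑ b, (dirDeriv X (g.coef e Y b) x • e b x
          + g.coef e Y b x • mlieBracket 𝓘(ℝ, Model d) X (e b) x) := by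
    intro X Y hY
    rw [mlieBracket_congr hU hx (fun _ _ => rfl) (fun y hy => he.field_expand Y hy),
      mlieBracket_sum _ _ (fun b => SmoothOn.smul (he.coef_smooth hY b) (he.smooth b)) hU hx]
    exact Finset.sum_congr rfl fun b _ =>
      mlieBracket_smul (he.coef_smooth hY b) (he.smooth b) hU hx
  have h1 : ∀ Z : VField d M, g.coef e Z c x = g.val x (Z x) (e (conj c) x) := fun _ => rfl
  have h2 : ∀ b, g.val x (mlieBracket 𝓘(ℝ, Model d) X (e b) x) (e (conj c) x)
      = -dirDeriv (e b) (g.coef e X c) x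
        + ∑ a, g.coef e X a x * g.coef e (mlieBracket 𝓘(ℝ, Model d) (e a) (e b)) c x := by
    intro b
    have : ∀ a, mlieBracket 𝓘(ℝ, Model d) (e b) (e a) x
      = -mlieBracket 𝓘(ℝ, Model d) (e a) (e b) x := fun a => mlieBracket_swap_apply
    rw [mlieBracket_swap_apply, key hX]
    simp only [this, Finset.sum_add_distrib, map_neg, map_add, map_sum, map_smul, smul_neg,
      neg_apply, add_apply, sum_apply,
      smul_apply, smul_eq_mul, he.val_eq hx, conj.injective.eq_iff, ← h1]
    simp [add_comm]
  rw [h1, key hY]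
  simp only [Finset.sum_add_distrib, map_add, map_sum, map_smul,
      add_apply, sum_apply,
      smul_apply, smul_eq_mul, he.val_eq hx, conj.injective.eq_iff, h2, mul_add]
  rw [he.dirDeriv_expand Y _ hx, Finset.sum_comm (γ := Fin (d + 2))]
  simp only [Finset.mul_sum, mul_neg, Finset.sum_neg_distrib]
  simp only [mul_ite, mul_one, mul_zero, Finset.sum_ite_eq, Finset.mem_univ, if_true]
  rw [Finset.sum_congr rfl fun b _ => Finset.sum_congr rfl fun a _ =>
    mul_left_comm (g.coef e Y b x) (g.coef e X a x) _]
  simp only [mul_assoc]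
  ring

end IsAdaptedFrame

end LorentzMetric

namespace FrameConnection

variable {d : ℕ} {A : Type*} [CommRing A]

/-! ### Vector fields and the evaluation of tensors -/

/-- The scalar product of two vector fields. -/
def dot (v w : Fin (d + 2) → A) : A := ∑ b, v b * w (conj b)

lemma dot_comm (v w : Fin (d + 2) → A) : dot v w = dot w v := by
  unfold dot
  rw [← sum_conj]
  exact Finset.sum_congr rfl fun b _ => by rw [conj_conj, mul_comm]

lemma add_dot (v v' w : Fin (d + 2) → A) : dot (fun b => v b + v' b) w = dot v w + dot v' w := by
  simp only [dot, add_mul, Finset.sum_add_distrib]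

lemma sub_dot (v v' w : Fin (d + 2) → A) : dot (fun b => v b - v' b) w = dot v w - dot v' w := by
  simp only [dot, sub_mul, Finset.sum_sub_distrib]

/-- The value of the tensor with components `τ` on a list of vector fields. -/
def eval : List (Fin (d + 2) → A) → Comp d A → A
  | [], τ => τ []
  | v :: vs, τ => ∑ a, v a * eval vs (fun l => τ (a :: l))

lemma eval_cons (v : Fin (d + 2) → A) (vs : List (Fin (d + 2) → A)) (τ : Comp d A) :
    eval (v :: vs) τ = ∑ a, v a * eval vs (fun l => τ (a :: l)) := rfl

lemma eval_sub (vs : List (Fin (d + 2) → A)) (σ τ : Comp d A) :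
    eval vs (fun l => σ l - τ l) = eval vs σ - eval vs τ := by
  induction vs generalizing σ τ with
  | nil => rfl
  | cons v vs ih => simp only [eval_cons, ih, mul_sub, Finset.sum_sub_distrib]

lemma eval_mul (vs : List (Fin (d + 2) → A)) (f : A) (τ : Comp d A) :
    eval vs (fun l => f * τ l) = f * eval vs τ := by
  induction vs generalizing τ with
  | nil => rfl
  | cons v vs ih => simp only [eval_cons, ih, Finset.mul_sum, mul_left_comm f]

lemma eval_add (vs : List (Fin (d + 2) → A)) (σ τ : Comp d A) :
    eval vs (fun l => σ l + τ l) = eval vs σ + eval vs τ := by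
  induction vs generalizing σ τ with
  | nil => rfl
  | cons v vs ih => simp only [eval_cons, ih, mul_add, Finset.sum_add_distrib]

lemma eval_sum {κ : Type*} (s : Finset κ) (vs : List (Fin (d + 2) → A)) (τ : κ → Comp d A) :
    eval vs (fun l => ∑ k ∈ s, τ k l) = ∑ k ∈ s, eval vs (τ k) := by
  classical
  induction s using Finset.induction_on with
  | empty => simpa using eval_mul vs 0 (fun _ => 0)
  | insert k s hk ih => simp only [Finset.sum_insert hk, eval_add, ih]

/-- The sum of the values obtained by applying `φ` to one of the arguments. -/
def evalSubst (φ : (Fin (d + 2) → A) → Fin (d + 2) → A) : List (Fin (d + 2) → A) → Comp d A → A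
  | [], _ => 0
  | v :: vs, τ => eval (φ v :: vs) τ + ∑ a, v a * evalSubst φ vs (fun l => τ (a :: l))

lemma eval_frame (l : List (Fin (d + 2))) (τ : Comp d A) :
    eval (l.map fun a => Pi.single a 1) τ = τ l := by
  induction l generalizing τ with
  | nil => rfl
  | cons a l ih =>
    rw [List.map_cons, eval_cons, Finset.sum_eq_single a, ih, Pi.single_eq_same, one_mul]
    · intro b _ hb
      rw [Pi.single_eq_of_ne hb, zero_mul]
    · simp

lemma sum_eval_update {k : ℕ} (φ : (Fin (d + 2) → A) → Fin (d + 2) → A)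
    (v : Fin k → Fin (d + 2) → A) (τ : Comp d A) :
    ∑ j, eval (List.ofFn (Function.update v j (φ (v j)))) τ = evalSubst φ (List.ofFn v) τ := by
  induction k generalizing τ with
  | zero => rfl
  | succ k ih =>
    rw [Fin.sum_univ_succ, List.ofFn_succ (f := v), evalSubst]
    congr 1
    · rw [List.ofFn_succ]
      simp
    · simp only [← ih (fun j => v j.succ), Finset.mul_sum]
      rw [Finset.sum_comm]
      refine Finset.sum_congr rfl fun j _ => ?_
      rw [List.ofFn_succ, eval_cons]
      have h0 : Function.update v j.succ (φ (v j.succ)) 0 = v 0 :=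
        Function.update_of_ne (Fin.succ_ne_zero j).symm _ _
      have h1 : (fun i : Fin k => Function.update v j.succ (φ (v j.succ)) i.succ)
          = Function.update (fun i => v i.succ) j (φ (v j.succ)) :=
        Function.update_comp_eq_of_injective v (Fin.succ_injective k) j _
      rw [h0, h1]

variable [Algebra ℝ A] (F : FrameConnection d A)

/-! ### Vector fields in terms of their components -/

/-- The derivative of a scalar along a vector field. -/
def fieldDeriv (X : Fin (d + 2) → A) (f : A) : A := ∑ a, X a * F.der a f

/-- The Lie bracket of two vector fields. -/
def bracket (X Y : Fin (d + 2) → A) : Fin (d + 2) → A := fun c =>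
  F.fieldDeriv X (Y c) - F.fieldDeriv Y (X c)
    + ∑ a, ∑ b, X a * Y b * (F.conn a b c - F.conn b a c)

/-- The covariant derivative of the vector field `Y` along the vector field `X`. -/
def nabField (X Y : Fin (d + 2) → A) : Fin (d + 2) → A := fun b =>
  F.fieldDeriv X (Y b) + ∑ a, ∑ c, X a * Y c * F.conn a c b

lemma fieldDeriv_dot (X Y Z : Fin (d + 2) → A) :
    F.fieldDeriv X (dot Y Z)
      = dot (fun b => F.fieldDeriv X (Y b)) Z + dot (fun b => F.fieldDeriv X (Z b)) Y := by
  rw [dot_comm (fun b => F.fieldDeriv X (Z b)) Y]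
  simp only [fieldDeriv, dot, map_sum, Derivation.leibniz, smul_eq_mul, mul_add,
    Finset.sum_add_distrib, Finset.mul_sum, Finset.sum_mul]
  rw [add_comm, Finset.sum_comm, Finset.sum_comm (f := fun a b => X a * (Y b * _))]
  congr 1 <;>
  exact Finset.sum_congr rfl fun b _ => Finset.sum_congr rfl fun a _ => by ring

lemma dot_conn_skew (X Y Z : Fin (d + 2) → A) :
    dot (fun b => ∑ a, ∑ c, X a * Y c * F.conn a c b) Z
      = -dot (fun b => ∑ a, ∑ c, X a * Z c * F.conn a c b) Y := by
  simp only [dot, Finset.sum_mul]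
  rw [Finset.sum_comm, Finset.sum_comm (γ := Fin (d + 2)) (f := fun b a => ∑ c, X a * Z c * _ * _),
    ← Finset.sum_neg_distrib]
  refine Finset.sum_congr rfl fun a _ => ?_
  rw [← sum_conj, Finset.sum_comm, ← sum_conj (fun b => ∑ c, X a * Z c * F.conn a c b * Y (conj b)),
    ← Finset.sum_neg_distrib]
  refine Finset.sum_congr rfl fun b _ => ?_
  rw [← Finset.sum_neg_distrib]
  refine Finset.sum_congr rfl fun c _ => ?_
  rw [conj_conj, conj_conj, F.skew a b c]; ring

lemma bracket_eq (X Y : Fin (d + 2) → A) :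
    F.bracket X Y = fun b => F.fieldDeriv X (Y b) - F.fieldDeriv Y (X b)
      + (∑ a, ∑ c, X a * Y c * F.conn a c b - ∑ a, ∑ c, Y a * X c * F.conn a c b) := by
  funext b
  simp only [bracket, mul_sub, Finset.sum_sub_distrib]
  rw [Finset.sum_comm (f := fun a c => Y a * X c * F.conn a c b)]
  simp only [mul_comm (Y _) (X _)]

/-- The Koszul formula. -/
lemma koszul_eq (X Y Z : Fin (d + 2) → A) :
    F.fieldDeriv X (dot Y Z) + F.fieldDeriv Y (dot X Z) - F.fieldDeriv Z (dot X Y)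
      + dot (F.bracket X Y) Z - dot (F.bracket X Z) Y - dot (F.bracket Y Z) X
      = 2 * dot (F.nabField X Y) Z := by
  have e : F.nabField X Y
      = fun b => F.fieldDeriv X (Y b) + ∑ a, ∑ c, X a * Y c * F.conn a c b := rfl
  simp only [fieldDeriv_dot, bracket_eq, e, add_dot, sub_dot]
  linear_combination -F.dot_conn_skew X Y Z - F.dot_conn_skew Y X Z + F.dot_conn_skew Z X Y

/-- The covariant derivative of a vector field along a frame vector. -/
def nabVec (a : Fin (d + 2)) (Z : Fin (d + 2) → A) : Fin (d + 2) → A := fun b =>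
  F.der a (Z b) + ∑ c, Z c * F.conn a c b

lemma nabField_eq (X Z : Fin (d + 2) → A) :
    F.nabField X Z = fun b => ∑ a, X a * F.nabVec a Z b := by
  funext b
  simp only [nabField, nabVec, fieldDeriv, mul_add, Finset.sum_add_distrib, Finset.mul_sum,
    mul_assoc]

lemma nabVec_sum (a : Fin (d + 2)) (Y : Fin (d + 2) → A) (W : Fin (d + 2) → Fin (d + 2) → A)
    (b : Fin (d + 2)) :
    F.nabVec a (fun b => ∑ q, Y q * W q b) b
      = ∑ q, (F.der a (Y q) * W q b + Y q * F.nabVec a (W q) b) := by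
  simp only [nabVec, map_sum, Derivation.leibniz, smul_eq_mul, Finset.sum_add_distrib, mul_add,
    Finset.sum_mul, Finset.mul_sum]
  rw [Finset.sum_comm (γ := Fin (d + 2)) (f := fun c q => Y q * W q c * F.conn a c b)]
  simp only [mul_assoc, mul_comm (W _ _) (F.der _ _)]
  ring

lemma nabVec_nabVec_sub (p q : Fin (d + 2)) (Z : Fin (d + 2) → A) (b : Fin (d + 2)) :
    F.nabVec p (F.nabVec q Z) b - F.nabVec q (F.nabVec p Z) b
      - ∑ c, (F.conn p q c - F.conn q p c) * F.nabVec c Z b = ∑ c, Z c * F.curv p q c b := by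
  have key : ∀ p q, F.nabVec p (F.nabVec q Z) b = F.der p (F.der q (Z b))
      + ∑ c, Z c * F.der p (F.conn q c b) + ∑ c, F.conn q c b * F.der p (Z c)
      + ∑ c, F.conn p c b * F.der q (Z c) + ∑ c, Z c * (F.conn q * F.conn p) c b := by
    intro p q
    have e : F.nabVec q Z = fun b => F.der q (Z b) + ∑ c, Z c * F.conn q c b := rfl
    rw [e, nabVec]
    simp only [map_add, map_sum, Derivation.leibniz, smul_eq_mul, Finset.sum_add_distrib, add_mul,
      Matrix.mul_apply, Finset.mul_sum, Finset.sum_mul]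
    rw [Finset.sum_comm (γ := Fin (d + 2)) (f := fun f c => Z c * F.conn q c f * F.conn p f b)]
    simp only [mul_assoc, mul_comm (F.der q (Z _)) (F.conn _ _ _)]
    ring
  have h := F.comm p q (Z b)
  have e : ∑ c, (F.conn p q c - F.conn q p c) * F.nabVec c Z b
      = ∑ c, (F.conn p q c - F.conn q p c) * F.der c (Z b)
        + ∑ c, Z c * ∑ f, (F.conn p q f - F.conn q p f) * F.conn f c b := by
    simp only [nabVec, mul_add, Finset.sum_add_distrib, Finset.mul_sum]
    rw [Finset.sum_comm (γ := Fin (d + 2))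
      (f := fun f c => (F.conn p q f - F.conn q p f) * (Z c * F.conn f c b))]
    simp only [mul_left_comm (Z _)]
  rw [key, key, e]
  simp only [curv, Matrix.sub_apply, Matrix.sum_apply, Matrix.smul_apply, Matrix.map_apply,
    smul_eq_mul, mul_sub, Finset.sum_sub_distrib]
  simp only [mul_sub, sub_mul, Finset.sum_sub_distrib] at h ⊢
  linear_combination h

/-- The curvature operator on vector fields. -/
lemma curvature_eq (X Y Z : Fin (d + 2) → A) (b : Fin (d + 2)) :
    F.nabField X (F.nabField Y Z) b - F.nabField Y (F.nabField X Z) b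
      - F.nabField (F.bracket X Y) Z b
      = ∑ p, ∑ q, ∑ c, X p * Y q * (Z c * F.curv p q c b) := by
  have key : ∀ X Y : Fin (d + 2) → A, F.nabField X (F.nabField Y Z) b
      = ∑ q, F.fieldDeriv X (Y q) * F.nabVec q Z b
        + ∑ p, ∑ q, X p * Y q * F.nabVec p (F.nabVec q Z) b := by
    intro X Y
    rw [F.nabField_eq Y Z, nabField_eq]
    simp only [nabVec_sum, Finset.sum_add_distrib, mul_add, fieldDeriv, Finset.mul_sum,
      Finset.sum_mul]
    rw [Finset.sum_comm]
    simp only [mul_assoc]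
  rw [key X Y, key Y X, nabField_eq]
  have hs : ∑ p, ∑ q, Y p * X q * F.nabVec p (F.nabVec q Z) b
      = ∑ p, ∑ q, X p * Y q * F.nabVec q (F.nabVec p Z) b := by
    rw [Finset.sum_comm]
    simp only [mul_comm (Y _) (X _)]
  have ht : ∑ c, (∑ p, ∑ q, X p * Y q * (F.conn p q c - F.conn q p c)) * F.nabVec c Z b
      = ∑ p, ∑ q, X p * Y q * ∑ c, (F.conn p q c - F.conn q p c) * F.nabVec c Z b := by
    simp only [Finset.sum_mul, Finset.mul_sum]
    rw [Finset.sum_comm]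
    refine Finset.sum_congr rfl fun p _ => ?_
    rw [Finset.sum_comm]
    simp only [mul_assoc]
  simp only [← Finset.mul_sum, ← nabVec_nabVec_sub, bracket, add_mul, sub_mul _ _ (F.nabVec _ _ _),
    mul_sub, Finset.sum_add_distrib, Finset.sum_sub_distrib] at ht ⊢
  rw [hs, ht]
  ring

/-- The Leibniz rule for the evaluation of a tensor. -/
lemma eval_grad (X : Fin (d + 2) → A) (vs : List (Fin (d + 2) → A)) (τ : Comp d A) :
    F.fieldDeriv X (eval vs τ) - evalSubst (F.nabField X) vs τ = eval (X :: vs) (F.grad τ) := by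
  rw [eval_cons]
  change _ = ∑ a, X a * eval vs (F.nab a τ)
  induction vs generalizing τ with
  | nil => simp [eval, evalSubst, fieldDeriv, nab]
  | cons v vs ih =>
    have h1 : F.fieldDeriv X (eval (v :: vs) τ)
        = ∑ b, F.fieldDeriv X (v b) * eval vs (fun l => τ (b :: l))
          + ∑ b, v b * F.fieldDeriv X (eval vs (fun l => τ (b :: l))) := by
      simp only [eval_cons, fieldDeriv, map_sum, Derivation.leibniz, smul_eq_mul, mul_add,
        Finset.mul_sum, Finset.sum_mul, Finset.sum_add_distrib]
      rw [add_comm, Finset.sum_comm, Finset.sum_comm (f := fun a b => X a * (v b * _))]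
      congr 1 <;>
      exact Finset.sum_congr rfl fun b _ => Finset.sum_congr rfl fun a _ => by ring
    have h2 : ∑ a, X a * eval (v :: vs) (F.nab a τ)
        = ∑ b, v b * ∑ a, X a * eval vs (F.nab a (fun l => τ (b :: l)))
          - ∑ b, (∑ a, ∑ c, X a * v c * F.conn a c b) * eval vs (fun l => τ (b :: l)) := by
      simp only [eval_cons, nab_cons, eval_sub, eval_sum, eval_mul, mul_sub, Finset.mul_sum,
        Finset.sum_mul, Finset.sum_sub_distrib]
      congr 1
      · rw [Finset.sum_comm]
        exact Finset.sum_congr rfl fun b _ => Finset.sum_congr rfl fun a _ => by ring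
      · rw [Finset.sum_comm (γ := Fin (d + 2)) (f := fun b a => ∑ c, X a * v c * F.conn a c b * _)]
        refine Finset.sum_congr rfl fun a _ => ?_
        rw [Finset.sum_comm]
        exact Finset.sum_congr rfl fun b _ => Finset.sum_congr rfl fun a _ => by ring
    rw [h1, h2, evalSubst, eval_cons]
    simp only [← ih, nabField, add_mul, mul_sub, Finset.sum_add_distrib, Finset.sum_sub_distrib]
    ring

/-- The values of the Riemann tensor are those of the curvature operator. -/
lemma dot_curv_eq_eval (W Z X Y : Fin (d + 2) → A) :
    dot (fun b => ∑ p, ∑ q, ∑ c, X p * Y q * (Z c * F.curv p q c b)) W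
      = eval [W, Z, X, Y] F.riem := by
  simp only [dot, eval, riem]
  rw [← sum_conj]
  refine Finset.sum_congr rfl fun a _ => ?_
  rw [conj_conj, mul_comm]
  congr 1
  rw [Finset.sum_congr rfl fun p _ => Finset.sum_comm, Finset.sum_comm]
  simp only [Finset.mul_sum]
  refine Finset.sum_congr rfl fun c _ => Finset.sum_congr rfl fun p _ =>
    Finset.sum_congr rfl fun q _ => by ring
lemma nabField_single (a c : Fin (d + 2)) :
    F.nabField (Pi.single a 1) (Pi.single c 1) = F.conn a c := by
  funext b
  have h : ∀ f, F.der f (Pi.single (M := fun _ => A) c 1 b) = 0 := fun f => by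
    rw [Pi.single_apply]; split_ifs <;> simp
  simp only [nabField, fieldDeriv, h, mul_zero, Finset.sum_const_zero, zero_add]
  rw [Finset.sum_eq_single a (fun b _ hb => by simp [hb]) (by simp),
    Finset.sum_eq_single c (fun b _ hb => by simp [hb]) (by simp)]
  simp

end FrameConnection

/-! ### The frame connection of the Levi-Civita connection -/

section EvalAt

variable {d : ℕ} {M : Type*} [TopologicalSpace M] [ChartedSpace (Model d) M] {U : Set M}

/-- The evaluation at a point of `U` of the smooth functions on `U`. -/
def evalAt {x : M} (hx : x ∈ U) : smoothRing d U →ₐ[ℝ] ℝ :=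
  (Pi.evalAlgHom ℝ (fun _ : U => ℝ) ⟨x, hx⟩).comp (smoothRing d U).val

@[simp] lemma evalAt_restr {x : M} (hx : x ∈ U) {f : M → ℝ} (hf : FunSmoothOn d f U) :
    evalAt hx (restr f hf) = f x := rfl

lemma extend_eq_evalAt {x : M} (hx : x ∈ U) (φ : smoothRing d U) : extend φ x = evalAt hx φ :=
  extend_apply φ ⟨x, hx⟩

lemma evalAt_ext {φ ψ : smoothRing d U} (h : ∀ x (hx : x ∈ U), evalAt hx φ = evalAt hx ψ) :
    φ = ψ := Subtype.ext (funext fun x => h x.1 x.2)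

end EvalAt

namespace LorentzMetric

variable {d : ℕ} {M : Type*} [TopologicalSpace M] [ChartedSpace (Model d) M]
  [IsManifold 𝓘(ℝ, Model d) ∞ M] {g : LorentzMetric d M} {ℓ : VField d M} {U : Set M}
  {e : Fin (d + 2) → VField d M}

open VectorField

namespace IsAdaptedFrame

variable (he : g.IsAdaptedFrame ℓ U e)

/-- The components of a vector field, as elements of the ring of smooth functions. -/
def cmp (X : VField d M) (hX : SmoothOn X U) (b : Fin (d + 2)) : smoothRing d U :=
  restr (g.coef e X b) (he.coef_smooth hX b)

@[simp] lemma evalAt_cmp {x : M} (hx : x ∈ U) (X : VField d M) (hX : SmoothOn X U)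
    (b : Fin (d + 2)) : evalAt hx (he.cmp X hX b) = g.coef e X b x := rfl

lemma cmp_frame (a : Fin (d + 2)) : he.cmp (e a) (he.smooth a) = Pi.single a 1 := by
  funext b
  refine evalAt_ext fun x hx => ?_
  rw [evalAt_cmp, he.coef_frame hx, Pi.single_apply]
  simp only [eq_comm, apply_ite (evalAt hx), map_one, map_zero]

/-- The components of the bracket of two frame vectors. -/
def structureFun (a b c : Fin (d + 2)) : smoothRing d U :=
  he.cmp (mlieBracket 𝓘(ℝ, Model d) (e a) (e b))
    (SmoothOn.mlieBracket (he.smooth a) (he.smooth b) he.isOpen) c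

lemma structureFun_swap (a b c : Fin (d + 2)) :
    he.structureFun b a c = -he.structureFun a b c := by
  refine evalAt_ext fun x hx => ?_
  simp only [structureFun, evalAt_cmp, map_neg, coef, inner]
  rw [mlieBracket_swap_apply, map_neg]; rfl

/-- The Christoffel symbols of the frame, from the Koszul formula. -/
def christoffel (a : Fin (d + 2)) : Matrix (Fin (d + 2)) (Fin (d + 2)) (smoothRing d U) :=
  Matrix.of fun c b => (1 / 2 : ℝ) • (he.structureFun a c b
    - he.structureFun a (conj b) (conj c) - he.structureFun c (conj b) (conj a))

lemma christoffel_torsion (p q c : Fin (d + 2)) :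
    he.christoffel p q c - he.christoffel q p c = he.structureFun p q c := by
  simp only [christoffel, Matrix.of_apply]
  rw [he.structureFun_swap p q c]
  module

lemma der_structureFun_add (p q r s : Fin (d + 2)) {x : M} (hx : x ∈ U) :
    g.coef e (mlieBracket 𝓘(ℝ, Model d) (e p) (mlieBracket 𝓘(ℝ, Model d) (e q) (e r))) s x
      = evalAt hx (fieldDer he.isOpen (e p) (he.smooth p) (he.structureFun q r s)
        + ∑ f, he.structureFun q r f * he.structureFun p f s) := by
  rw [he.coef_mlieBracket (he.smooth p)
    (SmoothOn.mlieBracket (he.smooth q) (he.smooth r) he.isOpen) hx]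
  have h : dirDeriv (mlieBracket 𝓘(ℝ, Model d) (e q) (e r)) (g.coef e (e p) s) x = 0 := by
    rw [dirDeriv_congr (Filter.eventually_of_mem (he.isOpen.mem_nhds hx) fun y hy =>
      he.coef_frame hy p s), dirDeriv_const]
  simp only [he.coef_frame hx, h, map_add, map_sum, map_mul, structureFun, cmp,
    fieldDer_restr, evalAt_restr, ite_mul, one_mul, zero_mul, sub_zero]
  congr 1
  rw [Finset.sum_eq_single p (fun a _ ha => by simp [ha.symm]) (by simp)]
  simp

/-- The Levi-Civita connection in an adapted frame. -/
def frameConnection : FrameConnection d (smoothRing d U) where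
  der a := fieldDer he.isOpen (e a) (he.smooth a)
  conn := he.christoffel
  skew x a b := by
    simp only [christoffel, Matrix.of_apply, conj_conj]
    rw [he.structureFun_swap a b]
    module
  comm p q φ := by
    simp only [christoffel_torsion]
    refine evalAt_ext fun x hx => ?_
    have h0 : e 0 x ≠ 0 := fun h => by
      have := he.val_eq hx 0 1
      simp [h] at this
    have h := dirDeriv_mlieBracket (he.smooth p) (he.smooth q) (extend_smooth φ) (he.smooth 0)
      he.isOpen hx h0
    rw [he.dirDeriv_expand _ _ hx] at h
    conv_lhs => rw [← restr_extend φ]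
    simp only [fieldDer_restr, map_sub, evalAt_restr, map_sum, map_mul]
    rw [← h]
    rfl
  jacobi p q r s := by
    simp only [christoffel_torsion]
    refine evalAt_ext fun x hx => ?_
    rw [map_add, map_add, ← he.der_structureFun_add, ← he.der_structureFun_add,
      ← he.der_structureFun_add, map_zero]
    have h := mlieBracket_jacobi (he.smooth p) (he.smooth q) (he.smooth r) he.isOpen hx
    have h2 : mlieBracket 𝓘(ℝ, Model d) (e q) (mlieBracket 𝓘(ℝ, Model d) (e r) (e p)) x
        = -mlieBracket 𝓘(ℝ, Model d) (e q) (mlieBracket 𝓘(ℝ, Model d) (e p) (e r)) x := by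
      have : mlieBracket 𝓘(ℝ, Model d) (e r) (e p) = -mlieBracket 𝓘(ℝ, Model d) (e p) (e r) :=
        funext fun y => mlieBracket_swap_apply
      have hs := SmoothOn.mlieBracket (he.smooth p) (he.smooth r) he.isOpen
      rw [this, ← neg_one_smul ℝ (mlieBracket _ (e p) (e r)),
        mlieBracket_const_smul_right (hs.mdifferentiableAt he.isOpen hx), neg_one_smul]
    have h3 : mlieBracket 𝓘(ℝ, Model d) (mlieBracket 𝓘(ℝ, Model d) (e p) (e q)) (e r) x
        = -mlieBracket 𝓘(ℝ, Model d) (e r) (mlieBracket 𝓘(ℝ, Model d) (e p) (e q)) x :=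
      mlieBracket_swap_apply
    simp only [coef, inner, h, h2, h3, map_add, map_neg, add_apply, neg_apply]
    ring

end IsAdaptedFrame

end LorentzMetric

namespace LorentzMetric

variable {d : ℕ} {M : Type*} [TopologicalSpace M] [ChartedSpace (Model d) M]
  [IsManifold 𝓘(ℝ, Model d) ∞ M] {g : LorentzMetric d M} {ℓ : VField d M} {U : Set M}
  {e : Fin (d + 2) → VField d M}

open VectorField FrameConnection

/-! ### Covariant derivatives in terms of components -/

variable (g e) in
/-- The component along `e b` of the covariant derivative of `Y` along `X`, expressed at a single
point by the derivatives of the components and the structure functions of the frame. Unlike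
`FrameConnection.nabField` it does not refer to the open set on which the frame is given. -/
def nabCoef (X Y : VField d M) (b : Fin (d + 2)) (x : M) : ℝ :=
  dirDeriv X (g.coef e Y b) x + ∑ a, ∑ c, g.coef e X a x * g.coef e Y c x *
    ((1 / 2 : ℝ) * (g.coef e (mlieBracket 𝓘(ℝ, Model d) (e a) (e c)) b x
      - g.coef e (mlieBracket 𝓘(ℝ, Model d) (e a) (e (conj b))) (conj c) x
      - g.coef e (mlieBracket 𝓘(ℝ, Model d) (e c) (e (conj b))) (conj a) x))

namespace IsAdaptedFrame

variable (he : g.IsAdaptedFrame ℓ U e) {X Y Z : VField d M}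

lemma cmp_congr {X Y : VField d M} (hX : SmoothOn X U) (hY : SmoothOn Y U)
    (h : ∀ x ∈ U, X x = Y x) : he.cmp X hX = he.cmp Y hY := by
  funext b
  refine evalAt_ext fun x hx => ?_
  simp only [evalAt_cmp, coef, inner, h x hx]

lemma fieldDeriv_restr (hX : SmoothOn X U) {f : M → ℝ} (hf : FunSmoothOn d f U) :
    he.frameConnection.fieldDeriv (he.cmp X hX) (restr f hf)
      = restr (dirDeriv X f) (hf.dirDeriv hX he.isOpen) := by
  refine evalAt_ext fun x hx => ?_
  simp only [fieldDeriv, frameConnection, fieldDer_restr, map_sum, map_mul, evalAt_cmp,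
    evalAt_restr]
  exact (he.dirDeriv_expand X f hx).symm

lemma dot_cmp (hX : SmoothOn X U) (hY : SmoothOn Y U) :
    dot (he.cmp X hX) (he.cmp Y hY) = restr (g.inner X Y) (g.inner_smooth hX hY) := by
  refine evalAt_ext fun x hx => ?_
  simp only [dot, map_sum, map_mul, evalAt_cmp, evalAt_restr]
  exact (he.inner_expand X Y hx).symm

lemma bracket_cmp (hX : SmoothOn X U) (hY : SmoothOn Y U) :
    he.frameConnection.bracket (he.cmp X hX) (he.cmp Y hY)
      = he.cmp (mlieBracket 𝓘(ℝ, Model d) X Y) (hX.mlieBracket hY he.isOpen) := by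
  funext c
  refine evalAt_ext fun x hx => ?_
  have h : ∀ a b, he.frameConnection.conn a b c - he.frameConnection.conn b a c
      = he.structureFun a b c := fun a b => he.christoffel_torsion a b c
  rw [evalAt_cmp, he.coef_mlieBracket hX hY hx, bracket]
  have hc : ∀ {X : VField d M} (hX : SmoothOn X U),
      he.cmp X hX c = restr (g.coef e X c) (he.coef_smooth hX c) := fun _ => rfl
  rw [hc hX, hc hY, fieldDeriv_restr, fieldDeriv_restr]
  simp only [h, map_add, map_sub, map_sum, map_mul, evalAt_restr, evalAt_cmp, structureFun]

lemma evalAt_nabField {x : M} (hx : x ∈ U) (hX : SmoothOn X U) (hY : SmoothOn Y U)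
    (b : Fin (d + 2)) :
    evalAt hx (he.frameConnection.nabField (he.cmp X hX) (he.cmp Y hY) b)
      = g.nabCoef e X Y b x := by
  have h : he.cmp Y hY b = restr (g.coef e Y b) (he.coef_smooth hY b) := rfl
  rw [nabField, nabCoef, h, fieldDeriv_restr]
  simp only [map_add, map_sum, map_mul, evalAt_restr, evalAt_cmp]
  rfl

include he in
/-- The Koszul formula determines the covariant derivative. -/
lemma koszul_eq {x : M} (hx : x ∈ U) (hX : SmoothOn X U) (hY : SmoothOn Y U) (hZ : SmoothOn Z U) :
    g.koszul X Y Z x = 2 * ∑ b, g.nabCoef e X Y b x * g.coef e Z (conj b) x := by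
  have h := congrArg (evalAt hx)
    (he.frameConnection.koszul_eq (he.cmp X hX) (he.cmp Y hY) (he.cmp Z hZ))
  simp only [dot_cmp, bracket_cmp, fieldDeriv_restr, map_add, map_sub, evalAt_restr] at h
  rw [koszul, h, dot]
  simp only [map_mul, map_sum, map_ofNat, evalAt_nabField, evalAt_cmp]

include he in
lemma nabla_eq {x : M} (hx : x ∈ U) (hX : SmoothOn X U) (hY : SmoothOn Y U) :
    g.nabla X Y x = ∑ b, g.nabCoef e X Y b x • e b x := by
  have key : ∀ Z : VField d M, SmoothNear Z x →
      2 * g.val x (∑ b, g.nabCoef e X Y b x • e b x) (Z x) = g.koszul X Y Z x := by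
    rintro Z ⟨V, hV, hxV, hZ⟩
    have hl : U ∩ V ⊆ U := Set.inter_subset_left
    rw [(he.mono hV).koszul_eq ⟨hx, hxV⟩ (hX.mono hl) (hY.mono hl)
      (hZ.mono Set.inter_subset_right)]
    simp only [map_sum, map_smul, sum_apply, smul_apply, smul_eq_mul, coef, inner, conj_conj,
      g.symm x (Z x)]
  have hex : ∃ v : TangentSpace 𝓘(ℝ, Model d) x,
      ∀ Z : VField d M, SmoothNear Z x → 2 * g.val x v (Z x) = g.koszul X Y Z x := ⟨_, key⟩
  rw [nabla, dif_pos hex]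
  refine he.vec_ext hx fun a => ?_
  have hs : SmoothNear (e a) x := ⟨U, he.isOpen, hx, he.smooth a⟩
  have := (hex.choose_spec (e a) hs).trans (key (e a) hs).symm
  linarith

include he in
lemma nabla_smooth (hX : SmoothOn X U) (hY : SmoothOn Y U) : SmoothOn (g.nabla X Y) U := by
  have h := SmoothOn.sum Finset.univ _ fun b =>
    SmoothOn.smul (extend_smooth (he.frameConnection.nabField (he.cmp X hX) (he.cmp Y hY) b))
      (he.smooth b)
  refine h.congr fun x hx => ?_
  simp only [he.nabla_eq hx hX hY, Finset.sum_apply, Pi.smul_apply', extend_eq_evalAt hx,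
    evalAt_nabField]

lemma cmp_nabla (hX : SmoothOn X U) (hY : SmoothOn Y U) :
    he.cmp (g.nabla X Y) (he.nabla_smooth hX hY)
      = he.frameConnection.nabField (he.cmp X hX) (he.cmp Y hY) := by
  funext b
  refine evalAt_ext fun x hx => ?_
  rw [evalAt_nabField, evalAt_cmp, coef, inner, he.nabla_eq hx hX hY, he.val_sum hx, conj_conj]

/-! ### Tensors in terms of components -/

/-- The tensor field `T` has the components `τ` in the frame. -/
def HasComp {k : ℕ} (T : TensorField d M k) (τ : Comp d (smoothRing d U)) : Prop :=
  ∀ (X : Fin k → VField d M) (hX : ∀ j, SmoothOn (X j) U), ∃ hT : FunSmoothOn d (T X) U,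
    restr (T X) hT = eval (List.ofFn fun j => he.cmp (X j) (hX j)) τ

variable {he}

lemma HasComp.apply_frame {k : ℕ} {T : TensorField d M k} {τ : Comp d (smoothRing d U)}
    (h : he.HasComp T τ) (a : Fin k → Fin (d + 2)) :
    ∃ hT : FunSmoothOn d (T fun j => e (a j)) U, restr _ hT = τ (List.ofFn a) := by
  obtain ⟨hT, h⟩ := h (fun j => e (a j)) fun j => he.smooth (a j)
  refine ⟨hT, h.trans ?_⟩
  simp only [cmp_frame]
  rw [← eval_frame (List.ofFn a) τ, List.map_ofFn]
  rfl

lemma HasComp.covDeriv {k : ℕ} {T : TensorField d M k} {τ : Comp d (smoothRing d U)}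
    (h : he.HasComp T τ) : he.HasComp (g.covDeriv T) (he.frameConnection.grad τ) := by
  intro X hX
  have hu : ∀ (j : Fin k) i, SmoothOn (Function.update (fun i : Fin k => X i.succ) j
      (g.nabla (X 0) (X j.succ)) i) U := by
    intro j i
    rcases eq_or_ne i j with rfl | hij
    · rw [Function.update_self]; exact he.nabla_smooth (hX 0) (hX _)
    · rw [Function.update_of_ne hij]; exact hX _
  obtain ⟨hT, h0⟩ := h (fun j => X j.succ) fun j => hX j.succ
  choose hTu h1 using fun j => h _ (hu j)
  have h2 : ∀ j, (fun i => he.cmp _ (hu j i))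
      = Function.update (fun i : Fin k => he.cmp (X i.succ) (hX _)) j
        (he.frameConnection.nabField (he.cmp (X 0) (hX 0)) (he.cmp (X j.succ) (hX j.succ))) := by
    intro j
    funext i
    rcases eq_or_ne i j with rfl | hij
    · rw [Function.update_self (f := fun i : Fin k => he.cmp (X i.succ) (hX _)), ← cmp_nabla]
      exact he.cmp_congr _ _ fun x _ => by rw [Function.update_self]
    · rw [Function.update_of_ne hij _ (fun i : Fin k => he.cmp (X i.succ) (hX _))]
      exact he.cmp_congr _ _ fun x _ => by rw [Function.update_of_ne hij]
  refine ⟨(hT.dirDeriv (hX 0) he.isOpen).sub (contMDiffOn_finsetSum fun j _ => hTu j), ?_⟩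
  rw [List.ofFn_succ, ← eval_grad, ← h0, fieldDeriv_restr, ← sum_eval_update]
  refine evalAt_ext fun x hx => ?_
  rw [map_sub, map_sum]
  have h3 : ∀ j, evalAt hx (eval (List.ofFn (Function.update
      (fun i : Fin k => he.cmp (X i.succ) (hX _)) j
        (he.frameConnection.nabField (he.cmp (X 0) (hX 0)) (he.cmp (X j.succ) (hX j.succ))))) τ)
      = T (Function.update (fun i : Fin k => X i.succ) j (g.nabla (X 0) (X j.succ))) x := by
    intro j
    rw [← h2, ← h1]; rfl
  simp only [h3]
  rfl

lemma HasComp.iterCovDeriv {k : ℕ} {T : TensorField d M k} {τ : Comp d (smoothRing d U)}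
    (h : he.HasComp T τ) (I : ℕ) :
    he.HasComp (g.iterCovDeriv T I) (he.frameConnection.grad^[I] τ) := by
  induction I with
  | zero => exact h
  | succ I ih => rw [Function.iterate_succ_apply']; exact ih.covDeriv

variable (he)

lemma hasComp_riemann : he.HasComp g.riemann he.frameConnection.riem := by
  intro X hX
  have hs := fun {X Y} => he.nabla_smooth (X := X) (Y := Y)
  have hb := (hX 2).mlieBracket (hX 3) he.isOpen
  have h1 := hs (hX 2) (hs (hX 3) (hX 1))
  have h2 := hs (hX 3) (hs (hX 2) (hX 1))
  have h3 := hs hb (hX 1)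
  have hT : FunSmoothOn d (g.riemann X) U :=
    (((g.inner_smooth h1 (hX 0)).sub (g.inner_smooth h2 (hX 0))).sub
      (g.inner_smooth h3 (hX 0))).congr fun x _ => by
        simp [riemann, curvature, inner]
  refine ⟨hT, ?_⟩
  have e1 : restr (g.riemann X) hT
      = dot (fun b => he.frameConnection.nabField (he.cmp _ (hX 2))
          (he.frameConnection.nabField (he.cmp _ (hX 3)) (he.cmp _ (hX 1))) b
        - he.frameConnection.nabField (he.cmp _ (hX 3))
          (he.frameConnection.nabField (he.cmp _ (hX 2)) (he.cmp _ (hX 1))) b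
        - he.frameConnection.nabField (he.frameConnection.bracket (he.cmp _ (hX 2))
          (he.cmp _ (hX 3))) (he.cmp _ (hX 1)) b) (he.cmp _ (hX 0)) := by
    simp only [bracket_cmp, ← cmp_nabla, sub_dot, dot_cmp]
    refine evalAt_ext fun x hx => ?_
    simp [riemann, curvature, inner]
  rw [e1]
  simp only [FrameConnection.curvature_eq]
  rw [dot_curv_eq_eval]
  simp [List.ofFn_succ]

end IsAdaptedFrame

end LorentzMetric

/-! ### Parallel frames -/

namespace FrameConnection

variable {d : ℕ} {A : Type*} [CommRing A] [Algebra ℝ A] {F : FrameConnection d A}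

/-- In a frame that is parallel along `e 0`, the components of a tensor are differentiated along
`e 0` by adding indices `0` to its covariant derivatives. -/
lemma iterate_grad_replicate (h : F.conn 0 = 0) (T : Comp d A) (k : ℕ) (l : List (Fin (d + 2))) :
    F.grad^[k] T (List.replicate k 0 ++ l) = (F.der 0)^[k] (T l) := by
  have h0 : ∀ (l : List (Fin (d + 2))) (T : Comp d A), act (0 : Matrix _ _ A) l T = 0 := by
    intro l
    induction l with
    | nil => intro T; rfl
    | cons a l ih => intro T; simp [act_cons, ih]
  induction k with
  | zero => rfl
  | succ k ih =>
    rw [Function.iterate_succ_apply', Function.iterate_succ_apply', List.replicate_succ,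
      List.cons_append, grad_cons, nab, ih, h, h0, sub_zero]

end FrameConnection

lemma listWt_ofFn {d k : ℕ} (a : Fin k → Fin (d + 2)) : listWt (List.ofFn a) = boostWeight a := by
  rw [listWt, List.map_ofFn, List.sum_ofFn]
  rfl

namespace LorentzMetric

variable {d : ℕ} {M : Type*} [TopologicalSpace M] [ChartedSpace (Model d) M]
  [IsManifold 𝓘(ℝ, Model d) ∞ M] {g : LorentzMetric d M} {ℓ : VField d M} {U : Set M}
  {e : Fin (d + 2) → VField d M}

open VectorField FrameConnection

namespace IsAdaptedFrame

section

variable (he : g.IsAdaptedFrame ℓ U e)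

lemma conn_eq (a c : Fin (d + 2)) :
    he.frameConnection.conn a c
      = he.cmp (g.nabla (e a) (e c)) (he.nabla_smooth (he.smooth a) (he.smooth c)) := by
  rw [he.cmp_nabla (he.smooth a) (he.smooth c), cmp_frame, cmp_frame, nabField_single]

lemma conn_zero_of_parallel (hp : g.IsParallelFrame U e) : he.frameConnection.conn 0 = 0 := by
  ext a b : 1
  refine evalAt_ext fun x hx => ?_
  rw [he.conn_eq, evalAt_cmp, coef, inner, hp x hx a]
  simp

lemma iterate_der_restr {f : M → ℝ} (hf : FunSmoothOn d f U) (a : Fin (d + 2)) (k : ℕ) :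
    ∃ hk : FunSmoothOn d ((dirDeriv (e a))^[k] f) U,
      (he.frameConnection.der a)^[k] (restr f hf) = restr _ hk := by
  induction k with
  | zero => exact ⟨hf, rfl⟩
  | succ k ih =>
    obtain ⟨hk, ih⟩ := ih
    simp only [Function.iterate_succ_apply', ih]
    exact ⟨hk.dirDeriv (he.smooth a) he.isOpen, fieldDer_restr he.isOpen (he.smooth a) hk⟩

/-! ### The hypotheses in terms of components -/

lemma isKundt (hK : g.IsKundt ℓ) : he.frameConnection.IsKundt := by
  intro c i hc hi0 hi1
  refine evalAt_ext fun x hx => ?_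
  rw [he.conn_eq, evalAt_cmp, coef, conj_of_ne hi0 hi1, map_zero]
  by_cases hc0 : c = 0
  · rw [hc0]; exact hK.geodesic U e he x hx i hi0 hi1
  · exact hK.optical U e he x hx i c hi0 hi1 hc0 hc

lemma evalAt_riem {x : M} (hx : x ∈ U) (a : Fin 4 → Fin (d + 2)) :
    evalAt hx (he.frameConnection.riem [a 0, a 1, a 2, a 3]) = g.riemann (fun j => e (a j)) x := by
  obtain ⟨hT, h⟩ := he.hasComp_riemann.apply_frame a
  have : [a 0, a 1, a 2, a 3] = List.ofFn a := by simp [List.ofFn_succ]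
  rw [this, ← h]; rfl

include he in
/-- Up to boost weight zero the tracefree Ricci tensor drops out of the products of the metric and
the Ricci tensor. -/
lemma eta_mul_ricci (hRicci : g.IsAlignedTypeIII ℓ g.tracefreeRicci) {x : M} (hx : x ∈ U)
    {a b p q : Fin (d + 2)} (h : 0 ≤ wt a + wt p + (wt b + wt q)) :
    g.inner (e a) (e p) x * g.ricci ![e b, e q] x
      = eta a p * (g.scalar x / ((d : ℝ) + 2) * eta b q) := by
  have hi : ∀ a b, g.inner (e a) (e b) x = eta a b := fun a b => he.val_eq hx a b
  by_cases h0 : wt a + wt p = 0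
  · have hb : -1 < boostWeight ![b, q] := by
      rw [← listWt_ofFn]; simp [List.ofFn_succ]; omega
    have h1 := hRicci U e he x hx ![b, q] hb
    have h2 : (fun j => e ((![b, q] : Fin 2 → Fin (d + 2)) j)) = ![e b, e q] := by
      funext j; fin_cases j <;> rfl
    rw [h2, tracefreeRicci] at h1
    change _ - _ * g.inner (e b) (e q) x = 0 at h1
    have h3 : g.ricci ![e b, e q] x = g.scalar x / ((d : ℝ) + 2) * eta b q := by
      rw [← hi]; linear_combination h1
    rw [hi, h3]
  · rw [hi, eta_eq_zero h0, zero_mul, zero_mul]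

include he in
lemma riemann_eq (hWeyl : g.IsAlignedTypeIII ℓ g.weyl)
    (hRicci : g.IsAlignedTypeIII ℓ g.tracefreeRicci) {x : M} (hx : x ∈ U)
    {a b p q : Fin (d + 2)} (h : 0 ≤ listWt [a, b, p, q]) :
    g.riemann (fun j => e ((![a, b, p, q] : Fin 4 → Fin (d + 2)) j)) x
      = (2 * (g.scalar x / ((d : ℝ) + 2)) / d - g.scalar x / (((d : ℝ) + 1) * d))
        * metricWedge [a, b, p, q] := by
  have hi : ∀ a b, g.inner (e a) (e b) x = eta a b := fun a b => he.val_eq hx a b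
  simp only [listWt_cons, listWt_nil] at h
  have hb : -1 < boostWeight ![a, b, p, q] := by
    rw [← listWt_ofFn]; simp [List.ofFn_succ]; omega
  have h1 := hWeyl U e he x hx ![a, b, p, q] hb
  have r1 := he.eta_mul_ricci hRicci hx (a := a) (b := b) (p := p) (q := q) (by omega)
  have r2 := he.eta_mul_ricci hRicci hx (a := a) (b := b) (p := q) (q := p) (by omega)
  have r3 := he.eta_mul_ricci hRicci hx (a := b) (b := a) (p := p) (q := q) (by omega)
  have r4 := he.eta_mul_ricci hRicci hx (a := b) (b := a) (p := q) (q := p) (by omega)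
  simp only [weyl] at h1
  change _ - (g.inner (e a) (e p) x * g.ricci ![e b, e q] x
    - g.inner (e a) (e q) x * g.ricci ![e b, e p] x - g.inner (e b) (e p) x * g.ricci ![e a, e q] x
    + g.inner (e b) (e q) x * g.ricci ![e a, e p] x) / (d : ℝ)
    + g.scalar x * (g.inner (e a) (e p) x * g.inner (e b) (e q) x
      - g.inner (e a) (e q) x * g.inner (e b) (e p) x) / _ = 0 at h1
  rw [r1, r2, r3, r4] at h1
  simp only [hi] at h1
  simp only [metricWedge]
  linear_combination h1

/-- The function `f` is the sectional component `R_{2323}`, which is smooth; the type III part of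
the curvature does not contribute to it. -/
lemma exists_isCurvatureTypeIII (hd : 2 ≤ d) (hWeyl : g.IsAlignedTypeIII ℓ g.weyl)
    (hRicci : g.IsAlignedTypeIII ℓ g.tracefreeRicci) :
    ∃ f Z, he.frameConnection.IsCurvatureTypeIII f Z := by
  obtain ⟨i, j, hi0, hi1, hj0, hj1, hij⟩ : ∃ i j : Fin (d + 2),
      i ≠ 0 ∧ i ≠ 1 ∧ j ≠ 0 ∧ j ≠ 1 ∧ i ≠ j :=
    ⟨⟨2, by omega⟩, ⟨3, by omega⟩, by simp [Fin.ext_iff]⟩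
  refine ⟨he.frameConnection.riem [i, j, i, j], fun l => he.frameConnection.riem l
    - he.frameConnection.riem [i, j, i, j] * metricWedge l, fun l hl => ?_, fun l => by ring⟩
  beta_reduce
  by_cases h4 : l.length = 4
  · obtain ⟨a, b, p, q, rfl⟩ := List.length_eq_four.1 h4
    have hG : (metricWedge [i, j, i, j] : ℝ) = 1 := by
      simp [metricWedge, eta, conj_of_ne, hi0, hi1, hj0, hj1, hij, hij.symm]
    refine evalAt_ext fun x hx => ?_
    have h1 := he.evalAt_riem hx ![a, b, p, q]
    have h2 := he.evalAt_riem hx ![i, j, i, j]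
    rw [he.riemann_eq hWeyl hRicci hx (by omega)] at h1
    rw [he.riemann_eq hWeyl hRicci hx (by simp [wt_of_ne, hi0, hi1, hj0, hj1]), hG] at h2
    have hw : evalAt hx (metricWedge [a, b, p, q] : smoothRing d U) = metricWedge [a, b, p, q] := by
      simp only [metricWedge, eta, map_sub, map_mul, apply_ite (evalAt hx), map_one, map_zero]
    change evalAt hx (he.frameConnection.riem [a, b, p, q]) = _ at h1
    change evalAt hx (he.frameConnection.riem [i, j, i, j]) = _ at h2
    rw [map_sub, map_mul, h1, h2, hw, map_zero]
    ring
  · rw [riem_eq_zero_of_length h4, metricWedge_eq_zero_of_length h4, mul_zero, sub_zero]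

lemma boostLE_iterate_grad_riem (hd : 2 ≤ d) (hK : g.IsKundt ℓ)
    (hWeyl : g.IsAlignedTypeIII ℓ g.weyl) (hRicci : g.IsAlignedTypeIII ℓ g.tracefreeRicci)
    {I : ℕ} (hI : 1 ≤ I) :
    BoostLE (-1) (he.frameConnection.grad^[I] he.frameConnection.riem) := by
  obtain ⟨f, Z, h⟩ := he.exists_isCurvatureTypeIII hd hWeyl hRicci
  exact h.boostLE_iterate_grad hd (he.isKundt hK) hI

variable {he}

lemma HasComp.eq_zero {k : ℕ} {T : TensorField d M k} {τ : Comp d (smoothRing d U)}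
    (h : he.HasComp T τ) {s : ℤ} (hτ : BoostLE s τ) {x : M} (hx : x ∈ U)
    {a : Fin k → Fin (d + 2)} (ha : s < boostWeight a) : T (fun j => e (a j)) x = 0 := by
  obtain ⟨hT, h⟩ := h.apply_frame a
  rw [← evalAt_restr hx hT, h, hτ _ (by rwa [listWt_ofFn]), map_zero]

end

end IsAdaptedFrame

/-! ### The curvature of the spacetime -/

section

variable (hd : 2 ≤ d) (hK : g.IsKundt ℓ) (hWeyl : g.IsAlignedTypeIII ℓ g.weyl)
  (hRicci : g.IsAlignedTypeIII ℓ g.tracefreeRicci)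

include hd hK hWeyl hRicci

lemma isAlignedTypeIII_iterCovDeriv_riemann {I : ℕ} (hI : 1 ≤ I) :
    g.IsAlignedTypeIII ℓ (g.iterCovDeriv g.riemann I) := fun _ _ he _ hx _ ha =>
  (he.hasComp_riemann.iterCovDeriv I).eq_zero
    (he.boostLE_iterate_grad_riem hd hK hWeyl hRicci hI) hx ha

lemma isAlignedTypeII_iterCovDeriv_riemann (I : ℕ) :
    g.IsAlignedTypeII ℓ (g.iterCovDeriv g.riemann I) := by
  intro U e he x hx a ha
  refine (he.hasComp_riemann.iterCovDeriv I).eq_zero ?_ hx ha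
  rcases Nat.eq_zero_or_pos I with rfl | hI
  · obtain ⟨f, Z, h⟩ := he.exists_isCurvatureTypeIII hd hWeyl hRicci
    exact h.boostLE_riem
  · exact (he.boostLE_iterate_grad_riem hd hK hWeyl hRicci hI).mono (by norm_num)

/-- In a parallel frame `D^k` of a component of boost weight `-k` is a component of boost weight
zero of a covariant derivative of higher order, which is of type III as well. -/
lemma isBalanced_iterCovDeriv_riemann {I : ℕ} (hI : 1 ≤ I) :
    g.IsBalanced ℓ (g.iterCovDeriv g.riemann I) := by
  intro U e he hp a
  refine ⟨fun hb x hx => isAlignedTypeIII_iterCovDeriv_riemann hd hK hWeyl hRicci hI U e he x hx a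
    (by omega), fun hb x hx => ?_⟩
  obtain ⟨hT, h⟩ := (he.hasComp_riemann.iterCovDeriv I).apply_frame a
  obtain ⟨hk, h'⟩ := he.iterate_der_restr hT 0 (-boostWeight a).toNat
  rw [← evalAt_restr hx hk, ← h', h, ← iterate_grad_replicate (he.conn_zero_of_parallel hp),
    ← Function.iterate_add_apply,
    he.boostLE_iterate_grad_riem hd hK hWeyl hRicci (by omega) _ ?_, map_zero]
  have : listWt (List.replicate (-boostWeight a).toNat 0 ++ List.ofFn a) = 0 := by
    rw [listWt_append, listWt_replicate_zero, listWt_ofFn]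
    omega
  omega

end

end LorentzMetric

end Kundt

end

theorem propositionA8 {d : ℕ} (hd : 2 ≤ d)
    {M : Type*} [TopologicalSpace M] [ChartedSpace (Kundt.Model d) M]
    [IsManifold 𝓘(ℝ, Kundt.Model d) ∞ M]
    (g : Kundt.LorentzMetric d M) (ℓ : Kundt.VField d M) (hK : g.IsKundt ℓ)
    (hWeyl : g.IsAlignedTypeIII ℓ g.weyl)
    (hRicci : g.IsAlignedTypeIII ℓ g.tracefreeRicci) :
    g.IsDegenerateKundt ℓ ∧
      ∀ I : ℕ, 1 ≤ I →
        g.IsBalanced ℓ (g.iterCovDeriv g.riemann I) ∧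
        g.IsAlignedTypeIII ℓ (g.iterCovDeriv g.riemann I) :=
  ⟨⟨hK, Kundt.LorentzMetric.isAlignedTypeII_iterCovDeriv_riemann hd hK hWeyl hRicci⟩,
    fun _ hI =>
      ⟨Kundt.LorentzMetric.isBalanced_iterCovDeriv_riemann hd hK hWeyl hRicci hI,
        Kundt.LorentzMetric.isAlignedTypeIII_iterCovDeriv_riemann hd hK hWeyl hRicci hI⟩⟩
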